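/- Let $d\ge 2$ and let $w_1\ge w_2\ge\dots\ge w_d>0$ be real numbers with $w_1+\dots+w_d=1$; put $\mathsf p_n=\sum_{i=1}^d w_i^n$. Let $S_\infty$ be the group of finite permutations of $\mathbb N=\{1,2,\dots\}$, with unit $e$ and star-transpositions $\gamma_n=(1,n+1)$, $n\ge 1$, and let $\chi:S_\infty\to\mathbb R$ be the character $\chi(\sigma)=\prod_V \mathsf p_{|V|}$, where $V$ runs over the orbits of $\sigma$ with $|V|\ge 2$. Let $U:S_\infty\to B(\mathcal H)$ be the GNS representation of $\chi$: the Hilbert space $\mathcal H$ is the closed linear span of vectors $\widehat\sigma$ $(\sigma\in S_\infty)$ with $\langle\widehat\sigma,\widehat\tau\rangle=\chi(\sigma\tau^{-1})$, and $U(\sigma)\widehat\tau=\widehat{\sigma\tau}$. Let $A_0\in B(\mathcal H)$ be the limit in the strong operator topology of $\frac1n\sum_{i=1}^n U(\gamma_i)$, and let $\mu_n$ be the law of the selfadjoint operator $s_n=\frac1{\sqrt n}\sum_{i=1}^n\bigl(U(\gamma_i)-A_0\bigr)$ with respect to the vector state of $\widehat e$, that is, the probability measure on $\mathbb R$ with $\int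 f\,d\mu_n=\langle f(s_n)\widehat e,\widehat e\rangle$ for all compactly supported continuous $f:\mathbb R\to\mathbb R$. A bicoloured pair-partition of $\{1,\dots,k\}$ is a partition $\rho$ of $\{1,\dots,k\}$ into pairs, each of which is painted blue or red; $\mathcal P_2^{(b-r)}(k)$ denotes the set of all of them (it is empty for $k$ odd). For such a $\rho$ let $\sigma_\rho^{\mathrm{blue}}$ be the product of the transpositions $(a,b)$ over the blue pairs $\{a,b\}$ of $\rho$, and let $\eta_k=(1,2,\dots,k)$, the permutation of $\{1,\dots,k\}$ with $1\mapsto 2\mapsto\cdots\mapsto k\mapsto 1$. Then the sequence $(\mu_n)$ converges weakly to a probability measure $\mu_{\underline w}$ on $\mathbb R$, which has finite moments of all orders, and for every integer $k\ge 1$ $$\int_{\mathbb R}t^k\,d\mu_{\underline w}(t)=\sum_{\underline i:\{1,\dots,k\}\to\{1,\dots,d\}}w_{\underline i(1)}\Biggl(\ \sum_{\substack{\rho\in\mathcal P_2^{(b-r)}(k)\\ \underline i\circ\eta_k=\underline i\circ\sigma_\rho^{\mathrm{blue}}}}\ \prod_{\substack{\{p,q\}\in\rho\ \text{blue},\\ p<q}}w_{\underline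 i(q)}\cdot\prod_{\substack{\{p,q\}\in\rho\ \text{red},\\ p<q}}\bigl(-w_{\underline i(p)}w_{\underline i(q)}\bigr)\Biggr).$$ -/

import Mathlib

open Filter Topology MeasureTheory
open scoped InnerProductSpace ComplexConjugate

noncomputable section

namespace StarCLT

/-- The group `S_∞` of finite permutations; the points `1, 2, 3, …` are labelled `0, 1, 2, …`. -/
def FinPerm : Subgroup (Equiv.Perm ℕ) where
  carrier := {σ | {n | σ n ≠ n}.Finite}
  one_mem' := by simp
  mul_mem' {σ τ} hσ hτ := by
    refine (Set.Finite.union hσ hτ).subset fun n hn => ?_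
    by_contra h
    simp only [Set.mem_union, Set.mem_ofPred_eq, not_or, not_not] at h
    exact hn (by simp [h.1, h.2])
  inv_mem' {σ} hσ := by
    refine Set.Finite.subset hσ fun n hn h => hn ?_
    exact Equiv.Perm.inv_eq_iff_eq.mpr h.symm

/-- The star-transposition `γ_n = (1, n+1)`, for `n ≥ 1` (here `0, n` are the points `1, n+1`). -/
def gam (n : ℕ) : FinPerm :=
  ⟨Equiv.swap 0 n, (Set.toFinite {0, n}).subset fun m hm => by
    by_contra h
    simp only [Set.mem_insert_iff, Set.mem_singleton_iff, not_or] at h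
    exact hm (Equiv.swap_apply_of_ne_of_ne h.1 h.2)⟩

/-- The orbits of a permutation of the points. -/
def orbits (σ : Equiv.Perm ℕ) : Set (Set ℕ) := Set.range fun n => {m | σ.SameCycle n m}

/-- A tuple of weights `w_1 ≥ ⋯ ≥ w_d > 0` with `w_1 + ⋯ + w_d = 1`. -/
structure Weights (d : ℕ) where
  w : Fin d → ℝ
  antitone : Antitone w
  pos : ∀ i, 0 < w i
  sum_eq_one : ∑ i, w i = 1

variable {d : ℕ} (W : Weights d)

/-- The power sums `p_n = w_1^n + ⋯ + w_d^n`. -/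
def Weights.powerSum (n : ℕ) : ℝ := ∑ i, W.w i ^ n

/-- The character `χ`: the product of `p_{|V|}` over the orbits `V` of `σ` with `|V| ≥ 2`. -/
def chi (σ : FinPerm) : ℝ :=
  ∏ᶠ V ∈ {V | V ∈ orbits (σ : Equiv.Perm ℕ) ∧ 2 ≤ V.ncard}, W.powerSum V.ncard

/-- Auxiliary: extension of a tuple to all points. -/
def extend {N : ℕ} (x : Fin N → Fin d) (n : ℕ) : Option (Fin d) :=
  if h : n < N then some (x ⟨n, h⟩) else none

theorem extend_comp_iff {N : ℕ} (x : Fin N → Fin d) (σ : Equiv.Perm ℕ) (hN : ∀ n, N ≤ n → σ n = n) :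
    extend x ∘ σ = extend x ↔ ∀ i j : Fin N, σ.SameCycle i j → x i = x j := by
  constructor
  · rintro h i j ⟨z, hz⟩
    have key : ∀ z : ℤ, ∀ n, extend x ((σ ^ z) n) = extend x n := by
      intro z
      induction z using Int.induction_on with
      | zero => simp
      | succ k ih => intro n; rw [zpow_add_one, Equiv.Perm.mul_apply, ih]; exact congrFun h n
      | pred k ih =>
        intro n
        rw [zpow_sub_one, Equiv.Perm.mul_apply, ih]
        have := congrFun h (σ⁻¹ n)
        simpa using this.symm
    have := key z i
    rw [hz] at this
    simp only [extend, Fin.is_lt, dif_pos, Fin.eta, Option.some.injEq] at this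
    exact this.symm
  · intro h
    funext n
    by_cases hn : n < N
    · have hs : σ.SameCycle n (σ n) := ⟨1, by simp⟩
      have hn' : σ n < N := by
        by_contra hc
        have := hN _ (not_lt.mp hc)
        have := σ.injective this
        omega
      simp only [Function.comp, extend, hn, hn', dif_pos]
      rw [h ⟨n, hn⟩ ⟨σ n, hn'⟩ hs]
    · simp [hN n (not_lt.mp hn)]

open Classical in
theorem chi_eq_sum (σ : FinPerm) (N : ℕ) (hN : ∀ n, N ≤ n → (σ : Equiv.Perm ℕ) n = n) :
    chi W σ = ∑ x : Fin N → Fin d,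
      if extend x ∘ (σ : Equiv.Perm ℕ) = extend x then ∏ i, W.w (x i) else 0 := by
  classical
  obtain ⟨σ, hσ⟩ := σ
  simp only at hN ⊢
  let r : Setoid (Fin N) :=
    ⟨fun i j => σ.SameCycle i j, fun i => Equiv.Perm.SameCycle.refl σ _, fun h => h.symm, fun h h' => h.trans h'⟩
  let Q := Quotient r
  let fib : Q → Finset (Fin N) := fun q => Finset.univ.filter fun i => (Quotient.mk r i) = q
  let e : Q → Set ℕ := fun q => ((fib q).image (fun i : Fin N => (i : ℕ)) : Finset ℕ)
  have hcard : ∀ q, (e q).ncard = (fib q).card := fun q => by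
    simp only [e, Set.ncard_coe_finset]
    exact Finset.card_image_of_injective _ Fin.val_injective
  have hmem : ∀ q (m : ℕ), m ∈ e q ↔ ∃ i : Fin N, Quotient.mk r i = q ∧ (i : ℕ) = m := by
    intro q m; simp [e, fib]
  have heinj : Function.Injective e := by
    intro q q' h
    induction q using Quotient.inductionOn with | _ i => ?_
    have : (i : ℕ) ∈ e q' := h ▸ (hmem _ _).2 ⟨i, rfl, rfl⟩
    obtain ⟨j, hj, hij⟩ := (hmem _ _).1 this
    rw [← hj, Fin.ext hij]
  have heorb : ∀ i : Fin N, e (Quotient.mk r i) = {m | σ.SameCycle i m} := by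
    intro i
    ext m
    rw [hmem]
    constructor
    · rintro ⟨j, hj, rfl⟩
      exact (Quotient.exact hj).symm
    · intro hm
      have hmN : m < N := by
        by_contra hc
        have hfix : Function.IsFixedPt σ m := hN m (not_lt.mp hc)
        have := hm.symm.eq_of_left hfix
        have := i.2
        omega
      exact ⟨⟨m, hmN⟩, Quotient.sound (Equiv.Perm.SameCycle.symm hm), rfl⟩
  have p1 : W.powerSum 1 = 1 := by simp [Weights.powerSum, W.sum_eq_one]
  have step1 : chi W ⟨σ, hσ⟩ = ∏ q : Q, W.powerSum (fib q).card := by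
    rw [← finprod_eq_prod_of_fintype]
    simp_rw [← hcard]
    rw [← finprod_mem_range (f := fun V : Set ℕ => W.powerSum V.ncard) heinj]
    unfold chi
    refine finprod_mem_inter_mulSupport_eq' _ _ _ fun V hV => ?_
    have hV1 : V.ncard ≠ 1 := fun h => hV (by simp [h, p1])
    constructor
    · rintro ⟨⟨n, rfl⟩, h2⟩
      have hn : n < N := by
        by_contra hc
        have hfix : Function.IsFixedPt σ n := hN n (not_lt.mp hc)
        have hss : {m | σ.SameCycle n m} ⊆ {n} := fun m hm => (hm.eq_of_left hfix).symm
        have := Set.ncard_le_ncard hss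
        simp only [Set.ncard_singleton] at this
        simp only at h2
        omega
      exact ⟨Quotient.mk r ⟨n, hn⟩, heorb _⟩
    · rintro ⟨q, rfl⟩
      induction q using Quotient.inductionOn with | _ i => ?_
      refine ⟨⟨i, (heorb i).symm⟩, ?_⟩
      have : 0 < (e (Quotient.mk r i)).ncard := by
        rw [hcard]
        exact Finset.card_pos.2 ⟨i, by simp [fib]⟩
      omega
  rw [step1]
  simp only [Weights.powerSum]
  rw [Finset.prod_univ_sum, Fintype.piFinset_univ, ← Finset.sum_filter]
  refine Finset.sum_bij' (fun y _ => fun i => y (Quotient.mk r i))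
    (fun x hx => Quotient.lift x
      ((extend_comp_iff x σ hN).1 (Finset.mem_filter.1 hx).2)) ?_ ?_ ?_ ?_ ?_
  · intro y _
    simp only [Finset.mem_filter, Finset.mem_univ, true_and]
    rw [extend_comp_iff _ _ hN]
    intro i j hij
    exact congrArg y (Quotient.sound hij)
  · simp
  · intro y _
    funext q
    induction q using Quotient.inductionOn with | _ i => rfl
  · intro x _; rfl
  · intro y _
    rw [← Finset.prod_fiberwise Finset.univ (fun i => Quotient.mk r i)]
    refine Finset.prod_congr rfl fun q _ => ?_
    rw [Finset.prod_congr rfl (g := fun _ => W.w (y q))]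
    · simp [fib]
    · intro i hi
      exact congrArg (fun q => W.w (y q)) (Finset.mem_filter.1 hi).2

theorem exists_bound (s : Finset FinPerm) :
    ∃ N, ∀ σ ∈ s, ∀ n, N ≤ n → (σ : Equiv.Perm ℕ) n = n := by
  classical
  induction s using Finset.induction_on with
  | empty => exact ⟨0, by simp⟩
  | insert a s ha ih =>
    obtain ⟨N, hN⟩ := ih
    obtain ⟨M, hM⟩ := Set.Finite.bddAbove a.2
    refine ⟨max N (M + 1), fun σ hσ n hn => ?_⟩
    rcases Finset.mem_insert.1 hσ with rfl | h
    · by_contra hc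
      have := hM hc
      omega
    · exact hN σ h n (by omega)

theorem chi_conj (ρ σ : FinPerm) : chi W (ρ * σ * ρ⁻¹) = chi W σ := by
  symm
  unfold chi
  refine finprod_mem_eq_of_bijOn (fun V => (ρ : Equiv.Perm ℕ) '' V) ⟨?_, ?_, ?_⟩ ?_
  · rintro _ ⟨⟨n, rfl⟩, h⟩
    refine ⟨⟨(ρ : Equiv.Perm ℕ) n, ?_⟩, ?_⟩
    · ext m
      simp only [Set.mem_ofPred_eq, Set.mem_image, Subgroup.coe_mul, Subgroup.coe_inv,
        Equiv.Perm.sameCycle_conj]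
      constructor
      · intro hm; exact ⟨_, by simpa using hm, by simp⟩
      · rintro ⟨k, hk, rfl⟩; simpa using hk
    · simpa [Set.ncard_image_of_injective _ (ρ : Equiv.Perm ℕ).injective] using h
  · exact (Set.image_injective.2 (ρ : Equiv.Perm ℕ).injective).injOn
  · rintro _ ⟨⟨n, rfl⟩, h⟩
    have heq : (ρ : Equiv.Perm ℕ) '' {m | (σ : Equiv.Perm ℕ).SameCycle ((ρ : Equiv.Perm ℕ)⁻¹ n) m} = {m | ((ρ * σ * ρ⁻¹ : FinPerm) : Equiv.Perm ℕ).SameCycle n m} := by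
      ext m
      simp only [Set.mem_ofPred_eq, Set.mem_image, Subgroup.coe_mul, Subgroup.coe_inv,
        Equiv.Perm.sameCycle_conj]
      constructor
      · rintro ⟨k, hk, rfl⟩; simpa using hk
      · intro hm; exact ⟨_, hm, by simp⟩
    refine ⟨_, ⟨⟨_, rfl⟩, ?_⟩, heq⟩
    simp only at h ⊢
    rwa [← heq, Set.ncard_image_of_injective _ (ρ : Equiv.Perm ℕ).injective] at h
  · intro V _
    simp only [Set.ncard_image_of_injective _ (ρ : Equiv.Perm ℕ).injective]

theorem chi_inv (σ : FinPerm) : chi W σ⁻¹ = chi W σ := by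
  simp [chi, orbits, Equiv.Perm.sameCycle_inv]

theorem chi_one : chi W 1 = 1 := by
  unfold chi
  refine finprod_mem_of_eqOn_one ?_
  rintro _ ⟨⟨n, rfl⟩, h⟩
  simp at h

theorem chi_nonneg_sum (c : FinPerm →₀ ℂ) :
    0 ≤ (c.sum fun σ a => c.sum fun τ b => conj a * b * (chi W (σ * τ⁻¹) : ℂ)).re := by
  classical
  obtain ⟨N, hN⟩ := exists_bound c.support
  have hN' : ∀ σ ∈ c.support, ∀ τ ∈ c.support, ∀ n, N ≤ n →
      ((σ * τ⁻¹ : FinPerm) : Equiv.Perm ℕ) n = n := by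
    intro σ hσ τ hτ n hn
    have : (τ : Equiv.Perm ℕ)⁻¹ n = n := Equiv.Perm.inv_eq_iff_eq.mpr (hN τ hτ n hn).symm
    rw [Subgroup.coe_mul, Subgroup.coe_inv, Equiv.Perm.mul_apply, this, hN σ hσ n hn]
  have key : (c.sum fun σ a => c.sum fun τ b => conj a * b * (chi W (σ * τ⁻¹) : ℂ)) =
      ∑ x : Fin N → Fin d, ((∏ i, W.w (x i) : ℝ) : ℂ) *
        ∑ f ∈ c.support.image (fun σ : FinPerm => extend x ∘ (σ : Equiv.Perm ℕ)),
          ((Complex.normSq (∑ σ ∈ c.support with extend x ∘ ((σ : FinPerm) : Equiv.Perm ℕ) = f, c σ) : ℝ) : ℂ) := by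
    have e1 : ∀ σ ∈ c.support, ∀ τ ∈ c.support, conj (c σ) * c τ * (chi W (σ * τ⁻¹) : ℂ) =
        ∑ x : Fin N → Fin d, ((∏ i, W.w (x i) : ℝ) : ℂ) *
          (if extend x ∘ (σ : Equiv.Perm ℕ) = extend x ∘ (τ : Equiv.Perm ℕ) then conj (c σ) * c τ else 0) := by
      intro σ hσ τ hτ
      rw [chi_eq_sum W _ N (hN' σ hσ τ hτ)]
      rw [Complex.ofReal_sum, Finset.mul_sum]
      refine Finset.sum_congr rfl fun x _ => ?_
      have : (extend x ∘ ((σ * τ⁻¹ : FinPerm) : Equiv.Perm ℕ) = extend x) ↔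
          (extend x ∘ (σ : Equiv.Perm ℕ) = extend x ∘ (τ : Equiv.Perm ℕ)) := by
        constructor
        · intro h
          have := congrArg (fun g => g ∘ (τ : Equiv.Perm ℕ)) h
          simp only [Function.comp_assoc] at this
          rw [← this]
          funext n; simp
        · intro h
          have := congrArg (fun g => g ∘ ((τ : Equiv.Perm ℕ)⁻¹ : Equiv.Perm ℕ)) h
          simp only [Function.comp_assoc] at this
          funext n
          have := congrFun this n
          simpa using this
      by_cases hx : extend x ∘ (σ : Equiv.Perm ℕ) = extend x ∘ (τ : Equiv.Perm ℕ)
      · rw [if_pos (this.2 hx), if_pos hx, mul_comm]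
      · rw [if_neg (fun h => hx (this.1 h)), if_neg hx, Complex.ofReal_zero, mul_zero, mul_zero]
    rw [Finsupp.sum, Finset.sum_congr rfl (fun σ hσ => by
      rw [Finsupp.sum, Finset.sum_congr rfl (fun τ hτ => e1 σ hσ τ hτ), Finset.sum_comm])]
    rw [Finset.sum_comm]
    refine Finset.sum_congr rfl fun x _ => ?_
    simp_rw [← Finset.mul_sum]
    congr 1
    rw [← Finset.sum_fiberwise_of_maps_to (s := c.support)
      (t := c.support.image (fun σ : FinPerm => extend x ∘ (σ : Equiv.Perm ℕ)))
      (g := fun σ : FinPerm => extend x ∘ (σ : Equiv.Perm ℕ))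
      (fun σ hσ => Finset.mem_image_of_mem _ hσ)]
    refine Finset.sum_congr rfl fun f _ => ?_
    rw [Complex.normSq_eq_conj_mul_self, map_sum, Finset.sum_mul_sum]
    refine Finset.sum_congr rfl fun σ hσ => ?_
    rw [(Finset.mem_filter.1 hσ).2, Finset.sum_filter]
    refine Finset.sum_congr rfl fun τ _ => ?_
    simp [eq_comm]
  rw [key]
  simp_rw [← Complex.ofReal_sum, ← Complex.ofReal_mul, ← Complex.ofReal_sum, Complex.ofReal_re]
  exact Finset.sum_nonneg fun x _ => mul_nonneg (Finset.prod_nonneg fun i _ => (W.pos _).le)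
    (Finset.sum_nonneg fun f _ => Complex.normSq_nonneg _)

/-- The algebraic span of the symbols `σ̂`, `σ ∈ S_∞`. -/
def PreGNS (_W : Weights d) : Type := FinPerm →₀ ℂ

instance : AddCommGroup (PreGNS W) := inferInstanceAs (AddCommGroup (FinPerm →₀ ℂ))
instance : Module ℂ (PreGNS W) := inferInstanceAs (Module ℂ (FinPerm →₀ ℂ))

/-- The sesquilinear form with `⟨σ̂, τ̂⟩ = χ(σ τ⁻¹)`. -/
def preInner (f g : FinPerm →₀ ℂ) : ℂ :=
  f.sum fun σ a => g.sum fun τ b => conj a * b * (chi W (σ * τ⁻¹) : ℂ)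

theorem preInner_conj (f g : FinPerm →₀ ℂ) : conj (preInner W g f) = preInner W f g := by
  unfold preInner
  rw [Finsupp.sum_comm]
  simp only [map_finsuppSum]
  refine Finsupp.sum_congr fun σ _ => Finsupp.sum_congr fun τ _ => ?_
  have : chi W (τ * σ⁻¹) = chi W (σ * τ⁻¹) := by rw [← chi_inv]; simp
  simp [this, mul_comm]

theorem preInner_add (f g h : FinPerm →₀ ℂ) :
    preInner W (f + g) h = preInner W f h + preInner W g h := by
  unfold preInner
  rw [Finsupp.sum_add_index'] <;> simp [← Finsupp.sum_add, add_mul]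

theorem preInner_smul (r : ℂ) (f g : FinPerm →₀ ℂ) :
    preInner W (r • f) g = conj r * preInner W f g := by
  unfold preInner
  rw [Finsupp.sum_smul_index] <;> simp [Finsupp.mul_sum, ← mul_assoc]

theorem preInner_mapDomain (σ : FinPerm) (f g : FinPerm →₀ ℂ) :
    preInner W (f.mapDomain fun τ => σ * τ) (g.mapDomain fun τ => σ * τ) = preInner W f g := by
  unfold preInner
  rw [Finsupp.sum_mapDomain_index (by simp) (by simp [← Finsupp.sum_add, add_mul])]
  refine Finsupp.sum_congr fun τ _ => ?_
  rw [Finsupp.sum_mapDomain_index (by simp) (by simp [mul_add, add_mul])]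
  refine Finsupp.sum_congr fun τ' _ => ?_
  rw [← chi_conj W σ (τ * τ'⁻¹)]
  simp [mul_assoc]

instance : PreInnerProductSpace.Core ℂ (PreGNS W) where
  inner f g := preInner W f g
  conj_inner_symm f g := preInner_conj W f g
  re_inner_nonneg f := chi_nonneg_sum W f
  add_left f g h := preInner_add W f g h
  smul_left f g r := preInner_smul W r f g

instance : SeminormedAddCommGroup (PreGNS W) :=
  InnerProductSpace.Core.toSeminormedAddCommGroup (𝕜 := ℂ)

instance : InnerProductSpace ℂ (PreGNS W) := .ofCore _

/-- The Hilbert space `H` of the GNS representation of `χ`. -/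
abbrev GNS : Type := UniformSpace.Completion (PreGNS W)

/-- The symbol of a permutation before completion. -/
def preKet (σ : FinPerm) : PreGNS W := Finsupp.single σ (1 : ℂ)

/-- The vector `σ̂ ∈ H`. -/
def ket (σ : FinPerm) : GNS W := (preKet W σ : PreGNS W)

theorem inner_ket (σ τ : FinPerm) : ⟪ket W σ, ket W τ⟫_ℂ = (chi W (σ * τ⁻¹) : ℂ) := by
  unfold ket
  rw [UniformSpace.Completion.inner_coe]
  change preInner W (Finsupp.single σ (1 : ℂ)) (Finsupp.single τ (1 : ℂ)) = _
  simp [preInner]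

theorem norm_ket (σ : FinPerm) : ‖ket W σ‖ = 1 := by
  have h := inner_self_eq_norm_sq_to_K (𝕜 := ℂ) (ket W σ)
  rw [inner_ket, mul_inv_cancel, chi_one] at h
  have h2 : ‖ket W σ‖ ^ 2 = 1 := by
    have h3 : ((‖ket W σ‖ ^ 2 : ℝ) : ℂ) = ((1 : ℝ) : ℂ) := by
      rw [Complex.ofReal_pow]; exact h.symm
    exact Complex.ofReal_injective h3
  have h4 := norm_nonneg (ket W σ)
  nlinarith

theorem span_preKet : Submodule.span ℂ (Set.range (preKet W)) = ⊤ := by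
  rw [eq_top_iff]
  rintro f -
  change FinPerm →₀ ℂ at f
  induction f using Finsupp.induction_linear with
  | zero => exact Submodule.zero_mem _
  | add f g hf hg => exact Submodule.add_mem _ hf hg
  | single σ a =>
    have : (Finsupp.single σ a : FinPerm →₀ ℂ) = a • Finsupp.single σ (1 : ℂ) := by simp
    rw [this]
    exact Submodule.smul_mem _ a (Submodule.subset_span ⟨σ, rfl⟩)

theorem dense_ket : Dense (Submodule.span ℂ (Set.range (ket W)) : Set (GNS W)) := by
  have h : Set.range ((↑) : PreGNS W → GNS W) ⊆ Submodule.span ℂ (Set.range (ket W)) := by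
    rintro _ ⟨f, rfl⟩
    have hf : f ∈ Submodule.span ℂ (Set.range (preKet W)) := by rw [span_preKet]; trivial
    induction hf using Submodule.span_induction with
    | mem x hx =>
      obtain ⟨σ, rfl⟩ := hx
      exact Submodule.subset_span ⟨σ, rfl⟩
    | zero => rw [UniformSpace.Completion.coe_zero]; exact Submodule.zero_mem _
    | add x y _ _ hx hy => rw [UniformSpace.Completion.coe_add]; exact Submodule.add_mem _ hx hy
    | smul a x _ hx => rw [UniformSpace.Completion.coe_smul]; exact Submodule.smul_mem _ a hx
  exact UniformSpace.Completion.denseRange_coe.mono h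

/-- Left multiplication by `σ` before completion. -/
def preU (σ : FinPerm) : PreGNS W →ₗ[ℂ] PreGNS W :=
  Finsupp.lmapDomain ℂ ℂ (fun τ => σ * τ)

theorem preInner_preU (σ : FinPerm) (f g : PreGNS W) :
    ⟪preU W σ f, preU W σ g⟫_ℂ = ⟪f, g⟫_ℂ := preInner_mapDomain W σ f g

/-- The operator `U(σ)` on `H`, with `U(σ) τ̂ = (σ τ)^`. -/
def U (σ : FinPerm) : GNS W →L[ℂ] GNS W :=
  ((preU W σ).isometryOfInner (preInner_preU W σ)).toContinuousLinearMap.completion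

theorem U_ket (σ τ : FinPerm) : U W σ (ket W τ) = ket W (σ * τ) := by
  unfold U ket
  rw [ContinuousLinearMap.completion_apply_coe]
  congr 1
  exact Finsupp.mapDomain_single

theorem inner_U (σ : FinPerm) (ξ η : GNS W) : ⟪U W σ ξ, U W σ η⟫_ℂ = ⟪ξ, η⟫_ℂ := by
  induction ξ, η using UniformSpace.Completion.induction_on₂ with
  | hp => exact isClosed_eq (by fun_prop) (by fun_prop)
  | ih f g =>
    unfold U
    rw [ContinuousLinearMap.completion_apply_coe, ContinuousLinearMap.completion_apply_coe,
      UniformSpace.Completion.inner_coe, UniformSpace.Completion.inner_coe]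
    exact preInner_preU W σ f g

theorem norm_U (σ : FinPerm) (ξ : GNS W) : ‖U W σ ξ‖ = ‖ξ‖ := by
  rw [@norm_eq_sqrt_re_inner ℂ, inner_U, ← @norm_eq_sqrt_re_inner ℂ]

theorem clm_ext {A B : GNS W →L[ℂ] GNS W} (h : ∀ σ, A (ket W σ) = B (ket W σ)) : A = B :=
  ContinuousLinearMap.ext_on (dense_ket W) (by rintro _ ⟨σ, rfl⟩; exact h σ)

theorem gam_mul_self (n : ℕ) : gam n * gam n = 1 := Subtype.ext (Equiv.swap_mul_self 0 n)

theorem isSelfAdjoint_U_gam (n : ℕ) : IsSelfAdjoint (U W (gam n)) := by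
  rw [ContinuousLinearMap.isSelfAdjoint_iff_isSymmetric]
  intro ξ η
  have h : U W (gam n) * U W (gam n) = 1 := clm_ext W fun σ => by
    simp [U_ket, ← mul_assoc, gam_mul_self]
  have h2 : U W (gam n) (U W (gam n) ξ) = ξ := by
    simpa using congrArg (fun A : GNS W →L[ℂ] GNS W => A ξ) h
  change ⟪U W (gam n) ξ, η⟫_ℂ = ⟪ξ, U W (gam n) η⟫_ℂ
  rw [← inner_U W (gam n), h2]

theorem chi_gam_mul {i j i' j' : ℕ} (hi : i ≠ 0) (hj : j ≠ 0) (hi' : i' ≠ 0) (hj' : j' ≠ 0)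
    (hij : i ≠ j) (hij' : i' ≠ j') :
    chi W (gam i * gam j) = chi W (gam i' * gam j') := by
  have conj1 : ∀ a b c : ℕ, a ≠ 0 → b ≠ 0 → c ≠ 0 → a ≠ b → a ≠ c →
      chi W (gam a * gam b) = chi W (gam a * gam c) ∧
      chi W (gam b * gam a) = chi W (gam c * gam a) := by
    intro a b c ha hb hc hab hac
    let ρ : FinPerm := ⟨Equiv.swap b c, (Set.toFinite {b, c}).subset fun m hm => by
      by_contra h
      simp only [Set.mem_insert_iff, Set.mem_singleton_iff, not_or] at h
      exact hm (Equiv.swap_apply_of_ne_of_ne h.1 h.2)⟩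
    have hsw : ∀ x y : ℕ, Equiv.swap b c * Equiv.swap x y * (Equiv.swap b c)⁻¹ =
        Equiv.swap (Equiv.swap b c x) (Equiv.swap b c y) := fun x y =>
      (Equiv.swap_apply_apply _ _ _).symm
    have h0 : Equiv.swap b c 0 = 0 := Equiv.swap_apply_of_ne_of_ne hb.symm hc.symm
    have h1 : ρ * gam a * ρ⁻¹ = gam a := Subtype.ext (by
      change Equiv.swap b c * Equiv.swap 0 a * (Equiv.swap b c)⁻¹ = Equiv.swap 0 a
      rw [hsw, h0, Equiv.swap_apply_of_ne_of_ne hab hac])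
    have h2 : ρ * gam b * ρ⁻¹ = gam c := Subtype.ext (by
      change Equiv.swap b c * Equiv.swap 0 b * (Equiv.swap b c)⁻¹ = Equiv.swap 0 c
      rw [hsw, h0, Equiv.swap_apply_left])
    constructor
    · rw [← chi_conj W ρ]
      congr 1
      calc ρ * (gam a * gam b) * ρ⁻¹ = (ρ * gam a * ρ⁻¹) * (ρ * gam b * ρ⁻¹) := by group
        _ = _ := by rw [h1, h2]
    · rw [← chi_conj W ρ]
      congr 1
      calc ρ * (gam b * gam a) * ρ⁻¹ = (ρ * gam b * ρ⁻¹) * (ρ * gam a * ρ⁻¹) := by group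
        _ = _ := by rw [h1, h2]
  let m := i + j + i' + j'
  have hm : m ≠ 0 ∧ i ≠ m ∧ i' ≠ m := by omega
  rw [(conj1 i j m hi hj hm.1 hij hm.2.1).1, (conj1 m i i' hm.1 hi hi' hm.2.1.symm hm.2.2.symm).2,
    (conj1 i' j' m hi' hj' hm.1 hij' hm.2.2).1]

/-- The averages `(U(γ_1) + ⋯ + U(γ_n)) / n`. -/
def avg (n : ℕ) : GNS W →L[ℂ] GNS W := (n : ℂ)⁻¹ • ∑ i ∈ Finset.Icc 1 n, U W (gam i)

theorem norm_avg_le (n : ℕ) (ξ : GNS W) : ‖avg W n ξ‖ ≤ ‖ξ‖ := by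
  simp only [avg, smul_apply, sum_apply, norm_smul]
  rcases Nat.eq_zero_or_pos n with rfl | hn
  · simp
  have : ‖∑ i ∈ Finset.Icc 1 n, U W (gam i) ξ‖ ≤ n * ‖ξ‖ := by
    refine (norm_sum_le _ _).trans ?_
    simp [norm_U]
  calc _ ≤ ‖(n : ℂ)⁻¹‖ * (n * ‖ξ‖) := by gcongr
    _ = ‖ξ‖ := by
      rw [norm_inv, Complex.norm_natCast]
      field_simp

theorem cauchySeq_avg_ket (τ : FinPerm) : CauchySeq fun n => avg W n (ket W τ) := by
  let c : ℝ := chi W (gam 1 * gam 2)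
  have hin : ∀ i j : ℕ, i ≠ 0 → j ≠ 0 →
      ⟪ket W (gam i * τ), ket W (gam j * τ)⟫_ℂ = (c + if i = j then 1 - c else 0 : ℝ) := by
    intro i j hi hj
    have hinv : (gam j)⁻¹ = gam j := inv_eq_of_mul_eq_one_left (gam_mul_self j)
    have : gam i * τ * (gam j * τ)⁻¹ = gam i * gam j := by
      rw [mul_inv_rev, hinv]; group
    rw [inner_ket, this]
    congr 1
    split_ifs with h
    · subst h; rw [gam_mul_self, chi_one]; ring
    · rw [add_zero]; exact chi_gam_mul W hi hj one_ne_zero two_ne_zero h (by norm_num)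
  have hdouble : ∀ n m : ℕ, m ≤ n → 0 < m →
      ⟪avg W n (ket W τ), avg W m (ket W τ)⟫_ℂ = ((c + (1 - c) / n : ℝ) : ℂ) ∧
      ⟪avg W m (ket W τ), avg W n (ket W τ)⟫_ℂ = ((c + (1 - c) / n : ℝ) : ℂ) := by
    intro n m hmn hm
    have hn : 0 < n := lt_of_lt_of_le hm hmn
    have e1 : ⟪avg W n (ket W τ), avg W m (ket W τ)⟫_ℂ = ((c + (1 - c) / n : ℝ) : ℂ) := by
      simp only [avg, smul_apply, sum_apply, U_ket,
        inner_smul_left, inner_smul_right, sum_inner, inner_sum]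
      have : ∑ j ∈ Finset.Icc 1 m, ∑ i ∈ Finset.Icc 1 n, ⟪ket W (gam i * τ), ket W (gam j * τ)⟫_ℂ
          = ∑ j ∈ Finset.Icc 1 m, ((n * c + (1 - c) : ℝ) : ℂ) := by
        refine Finset.sum_congr rfl fun j hj => ?_
        have hj' := Finset.mem_Icc.1 hj
        rw [Finset.sum_congr rfl fun i hi =>
          hin i j (by have := Finset.mem_Icc.1 hi; omega) (by omega), ← Complex.ofReal_sum]
        congr 1
        rw [Finset.sum_add_distrib, Finset.sum_ite_eq', if_pos (Finset.mem_Icc.2 (by omega))]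
        simp
      rw [← Finset.mul_sum, this]
      simp only [Finset.sum_const, Nat.card_Icc, add_tsub_cancel_right, nsmul_eq_mul, map_inv₀,
        map_natCast]
      push_cast
      have : (n : ℂ) ≠ 0 := by exact_mod_cast hn.ne'
      have : (m : ℂ) ≠ 0 := by exact_mod_cast hm.ne'
      field_simp
    refine ⟨e1, ?_⟩
    rw [← inner_conj_symm, e1, Complex.conj_ofReal]
  have hdist : ∀ n m : ℕ, m ≤ n → 0 < m →
      ‖avg W n (ket W τ) - avg W m (ket W τ)‖ ^ 2 = (1 - c) * (1 / m - 1 / n) := by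
    intro n m hmn hm
    have hn : 0 < n := lt_of_lt_of_le hm hmn
    have : ((‖avg W n (ket W τ) - avg W m (ket W τ)‖ ^ 2 : ℝ) : ℂ) =
        (((1 - c) * (1 / m - 1 / n) : ℝ) : ℂ) := by
      have h := inner_self_eq_norm_sq_to_K (𝕜 := ℂ) (avg W n (ket W τ) - avg W m (ket W τ))
      rw [inner_sub_left, inner_sub_right, inner_sub_right, (hdouble n m hmn hm).1,
        (hdouble n m hmn hm).2, (hdouble n n le_rfl hn).1, (hdouble m m le_rfl hm).1] at h
      push_cast at h ⊢
      rw [show ((‖avg W n (ket W τ) - avg W m (ket W τ)‖ : ℝ) : ℂ) ^ 2 = _ from h.symm]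
      ring
    exact_mod_cast this
  rw [Metric.cauchySeq_iff']
  intro ε hε
  obtain ⟨N, hN⟩ := exists_nat_gt (|1 - c| / ε ^ 2)
  refine ⟨N + 1, fun n hn => ?_⟩
  rw [dist_eq_norm]
  refine lt_of_pow_lt_pow_left₀ 2 hε.le ?_
  rw [hdist n (N + 1) hn (Nat.succ_pos _)]
  have hN1 : (0 : ℝ) < ((N + 1 : ℕ) : ℝ) := by positivity
  have hn1 : ((N + 1 : ℕ) : ℝ) ≤ n := by exact_mod_cast hn
  have hb : 0 ≤ 1 / ((N + 1 : ℕ) : ℝ) - 1 / n := sub_nonneg.2 (one_div_le_one_div_of_le hN1 hn1)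
  have hb2 : 1 / ((N + 1 : ℕ) : ℝ) - 1 / n ≤ 1 / ((N + 1 : ℕ) : ℝ) :=
    sub_le_self _ (by positivity)
  calc (1 - c) * (1 / ((N + 1 : ℕ) : ℝ) - 1 / n) ≤ |1 - c| * (1 / ((N + 1 : ℕ) : ℝ)) :=
        mul_le_mul (le_abs_self _) hb2 hb (abs_nonneg _)
    _ < ε ^ 2 := by
      rw [mul_one_div, div_lt_iff₀ hN1]
      rw [div_lt_iff₀ (by positivity)] at hN
      push_cast
      nlinarith [sq_nonneg ε]

theorem exists_lim_avg (ξ : GNS W) : ∃ η, Tendsto (fun n => avg W n ξ) atTop (𝓝 η) := by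
  refine cauchySeq_tendsto_of_complete ?_
  have hspan : ∀ ζ ∈ Submodule.span ℂ (Set.range (ket W)), CauchySeq fun n => avg W n ζ := by
    intro ζ hζ
    induction hζ using Submodule.span_induction with
    | mem x hx => obtain ⟨σ, rfl⟩ := hx; exact cauchySeq_avg_ket W σ
    | zero => simpa using cauchySeq_const (0 : GNS W)
    | add x y _ _ hx hy => simp only [map_add]; exact hx.add hy
    | smul a x _ hx =>
      simp only [map_smul]; exact (uniformContinuous_const_smul a).comp_cauchySeq hx
  rw [Metric.cauchySeq_iff]
  intro ε hε
  obtain ⟨ζ, hζ, hd⟩ := Metric.dense_iff.1 (dense_ket W) ξ (ε / 4) (by positivity)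
  obtain ⟨N, hN⟩ := Metric.cauchySeq_iff.1 (hspan ζ hd) (ε / 4) (by positivity)
  refine ⟨N, fun m hm n hn => ?_⟩
  have hb : ∀ k, dist (avg W k ξ) (avg W k ζ) < ε / 4 := fun k => by
    rw [dist_eq_norm, ← map_sub]
    refine (norm_avg_le W k _).trans_lt ?_
    rw [← dist_eq_norm, dist_comm]; exact hζ
  have h1 := hb m
  have h2 := hb n
  have h3 := hN m hm n hn
  have h4 := dist_triangle4 (avg W m ξ) (avg W m ζ) (avg W n ζ) (avg W n ξ)
  rw [dist_comm (avg W n ζ)] at h4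
  linarith

/-- The operator `A_0`, the limit of the averages `(U(γ_1) + ⋯ + U(γ_n)) / n` in the strong
operator topology. -/
def A₀ : GNS W →L[ℂ] GNS W :=
  continuousLinearMapOfTendsto (l := atTop) (avg W)
    (f := fun ξ => (exists_lim_avg W ξ).choose)
    (tendsto_pi_nhds.2 fun ξ => (exists_lim_avg W ξ).choose_spec)

theorem tendsto_avg (ξ : GNS W) : Tendsto (fun n => avg W n ξ) atTop (𝓝 (A₀ W ξ)) :=
  (exists_lim_avg W ξ).choose_spec

theorem isSelfAdjoint_avg (n : ℕ) : IsSelfAdjoint (avg W n) := by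
  refine IsSelfAdjoint.smul ?_ (isSelfAdjoint_sum _ fun i _ => isSelfAdjoint_U_gam W i)
  simp [IsSelfAdjoint]

theorem isSelfAdjoint_A₀ : IsSelfAdjoint (A₀ W) := by
  rw [ContinuousLinearMap.isSelfAdjoint_iff_isSymmetric]
  intro ξ η
  have h1 : Tendsto (fun n => ⟪avg W n ξ, η⟫_ℂ) atTop (𝓝 ⟪A₀ W ξ, η⟫_ℂ) :=
    (tendsto_avg W ξ).inner tendsto_const_nhds
  have h2 : Tendsto (fun n => ⟪ξ, avg W n η⟫_ℂ) atTop (𝓝 ⟪ξ, A₀ W η⟫_ℂ) :=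
    tendsto_const_nhds.inner (tendsto_avg W η)
  refine tendsto_nhds_unique h1 (h2.congr fun n => ?_)
  exact ((ContinuousLinearMap.isSelfAdjoint_iff_isSymmetric.1 (isSelfAdjoint_avg W n)) ξ η).symm

/-- The rescaled average `s_n = n^{-1/2} ∑_{i=1}^n (U(γ_i) - A_0)`. -/
def s (n : ℕ) : selfAdjoint (GNS W →L[ℂ] GNS W) :=
  ⟨((Real.sqrt n)⁻¹ : ℝ) • ∑ i ∈ Finset.Icc 1 n, (U W (gam i) - A₀ W),
    IsSelfAdjoint.smul (by simp [IsSelfAdjoint]) (isSelfAdjoint_sum _ fun i _ =>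
      (isSelfAdjoint_U_gam W i).sub (isSelfAdjoint_A₀ W))⟩

section Law

open scoped CompactlySupported

variable {H : Type} [NormedAddCommGroup H] [InnerProductSpace ℂ H] [CompleteSpace H]

/-- The positive functional `f ↦ ⟨f(T) ξ, ξ⟩` given by the continuous functional calculus. -/
def lawFunctional (T : selfAdjoint (H →L[ℂ] H)) (ξ : H) : C_c(ℝ, ℝ) →ₚ[ℝ] ℝ :=
  PositiveLinearMap.mk₀
    { toFun := fun f => (⟪ξ, cfc (f : ℝ → ℝ) (T : H →L[ℂ] H) ξ⟫_ℂ).re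
      map_add' := fun f g => by
        have := cfc_add (a := (T : H →L[ℂ] H)) (f : ℝ → ℝ) (g : ℝ → ℝ) (by fun_prop) (by fun_prop)
        simp only [CompactlySupportedContinuousMap.coe_add]
        change (⟪ξ, (cfc (fun x => f x + g x) (T : H →L[ℂ] H)) ξ⟫_ℂ).re = _
        rw [this]
        simp
      map_smul' := fun r f => by
        have := cfc_smul (a := (T : H →L[ℂ] H)) r (f : ℝ → ℝ) (by fun_prop)
        change (⟪ξ, (cfc (fun x => r • f x) (T : H →L[ℂ] H)) ξ⟫_ℂ).re = _
        rw [this]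
        simp [inner_smul_right_eq_smul] }
    (fun f hf => by
      have h : 0 ≤ cfc (f : ℝ → ℝ) (T : H →L[ℂ] H) := cfc_nonneg fun x _ => hf x
      have h2 := ((ContinuousLinearMap.nonneg_iff_isPositive _).1 h).inner_nonneg_right ξ
      exact (Complex.le_def.1 h2).1)

/-- The law of the selfadjoint operator `T` with respect to the vector state of `ξ`: the measure
with `∫ f = ⟨f(T) ξ, ξ⟩` for every `f` continuous with compact support. -/
def lawMeasure (T : selfAdjoint (H →L[ℂ] H)) (ξ : H) : Measure ℝ :=
  RealRMK.rieszMeasure (lawFunctional T ξ)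

theorem integral_lawMeasure (T : selfAdjoint (H →L[ℂ] H)) (ξ : H) (f : C_c(ℝ, ℝ)) :
    ∫ t, f t ∂(lawMeasure T ξ) = (⟪ξ, cfc (f : ℝ → ℝ) (T : H →L[ℂ] H) ξ⟫_ℂ).re :=
  RealRMK.integral_rieszMeasure (lawFunctional T ξ) f

theorem exists_plateau (R : ℝ) : ∃ f : C_c(ℝ, ℝ), (∀ x, 0 ≤ f x ∧ f x ≤ 1) ∧
    ∀ x ∈ Metric.closedBall (0 : ℝ) R, f x = 1 := by
  obtain ⟨f, h1, -, h2, h3⟩ := exists_continuous_one_zero_of_isCompact (X := ℝ)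
    (isCompact_closedBall (0 : ℝ) R) (isClosed_empty) (Set.disjoint_empty _)
  exact ⟨⟨f, h2⟩, fun x => ⟨(h3 x).1, (h3 x).2⟩, fun x hx => h1 hx⟩

theorem isProbabilityMeasure_lawMeasure (T : selfAdjoint (H →L[ℂ] H)) (ξ : H) (hξ : ‖ξ‖ = 1) :
    IsProbabilityMeasure (lawMeasure T ξ) := by
  have hΛ : ∀ f : C_c(ℝ, ℝ), (∀ x ∈ Metric.closedBall (0 : ℝ) ‖(T : H →L[ℂ] H)‖, f x = 1) →
      lawFunctional T ξ f = 1 := by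
    intro f hf
    have hT : IsSelfAdjoint (T : H →L[ℂ] H) := T.2
    have h1 : cfc (f : ℝ → ℝ) (T : H →L[ℂ] H) = 1 := by
      have : Nontrivial H := ⟨ξ, 0, fun h => by simp [h] at hξ⟩
      rw [← cfc_one ℝ (T : H →L[ℂ] H) hT]
      refine cfc_congr fun x hx => ?_
      refine hf x ?_
      have := spectrum.norm_le_norm_of_mem hx
      simpa using this
    change (⟪ξ, cfc (f : ℝ → ℝ) (T : H →L[ℂ] H) ξ⟫_ℂ).re = 1
    rw [h1]
    simp only [one_apply_eq_self, inner_self_eq_norm_sq_to_K, hξ]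
    norm_num
  constructor
  refine le_antisymm ?_ ?_
  · have hU : (Set.univ : Set ℝ) = ⋃ n : ℕ, Metric.closedBall (0 : ℝ) (‖(T : H →L[ℂ] H)‖ + n) := by
      symm
      rw [Set.iUnion_eq_univ_iff]
      intro x
      obtain ⟨n, hn⟩ := exists_nat_ge |x|
      refine ⟨n, ?_⟩
      simp only [Metric.mem_closedBall, dist_zero_right, Real.norm_eq_abs]
      have := norm_nonneg (T : H →L[ℂ] H)
      linarith
    rw [hU, Monotone.measure_iUnion]
    · refine iSup_le fun n => ?_
      obtain ⟨f, hf, hf1⟩ := exists_plateau (‖(T : H →L[ℂ] H)‖ + n)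
      refine (RealRMK.rieszMeasure_le_of_eq_one _ (fun x => (hf x).1)
        (isCompact_closedBall _ _) hf1).trans ?_
      rw [hΛ f fun x hx => hf1 x (Metric.closedBall_subset_closedBall (by simp) hx)]
      simp
    · intro a b hab
      refine Metric.closedBall_subset_closedBall ?_
      have : (a : ℝ) ≤ b := by exact_mod_cast hab
      linarith
  · obtain ⟨f, hf, hf1⟩ := exists_plateau ‖(T : H →L[ℂ] H)‖
    have := RealRMK.le_rieszMeasure_tsupport_subset (Λ := lawFunctional T ξ) hf
      (Set.subset_univ _)
    rwa [hΛ f hf1, ENNReal.ofReal_one] at this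

/-- The law of `T` with respect to the vector state of the unit vector `ξ`, as a probability
measure. -/
def law (T : selfAdjoint (H →L[ℂ] H)) (ξ : H) (hξ : ‖ξ‖ = 1) : ProbabilityMeasure ℝ :=
  ⟨lawMeasure T ξ, isProbabilityMeasure_lawMeasure T ξ hξ⟩

end Law

/-- The law `μ_n` of `s_n` with respect to the vector state of `ê`, `e` the unit of `S_∞`. -/
def cltLaw (n : ℕ) : ProbabilityMeasure ℝ := law (s W n) (ket W 1) (norm_ket W 1)

/-- A bicoloured pair-partition of `{1, …, k}`: a partition into pairs, some of which are painted
blue, the others being red. -/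
structure BicolouredPairPartition (k : ℕ) where
  toFinpartition : Finpartition (Finset.univ : Finset (Fin k))
  card_eq_two : ∀ V ∈ toFinpartition.parts, V.card = 2
  blue : Finset (Finset (Fin k))
  blue_subset : blue ⊆ toFinpartition.parts

namespace BicolouredPairPartition

variable {k : ℕ}

instance : Fintype (BicolouredPairPartition k) :=
  Fintype.ofInjective (fun ρ => (ρ.toFinpartition, ρ.blue)) fun ρ ρ' h => by
    cases ρ; cases ρ'; simp_all

variable (ρ : BicolouredPairPartition k)

/-- The red pairs. -/
def red : Finset (Finset (Fin k)) := ρ.toFinpartition.parts \ ρ.blue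

/-- The `(p, q)` with `p < q` such that `{p, q}` is a blue pair. -/
def bluePairs : Finset (Fin k × Fin k) :=
  Finset.univ.filter fun x => x.1 < x.2 ∧ {x.1, x.2} ∈ ρ.blue

/-- The `(p, q)` with `p < q` such that `{p, q}` is a red pair. -/
def redPairs : Finset (Fin k × Fin k) :=
  Finset.univ.filter fun x => x.1 < x.2 ∧ {x.1, x.2} ∈ ρ.red

theorem pairwise_commute :
    (ρ.bluePairs : Set (Fin k × Fin k)).Pairwise
      (Function.onFun Commute fun x => Equiv.swap x.1 x.2) := by
  rintro ⟨a, b⟩ hx ⟨c, e⟩ hy hne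
  simp only [bluePairs, Finset.coe_filter, Finset.mem_univ, true_and, Set.mem_ofPred_eq] at hx hy
  have hset : ({a, b} : Finset (Fin k)) ≠ {c, e} := by
    intro h
    apply hne
    have ha : a ∈ ({c, e} : Finset (Fin k)) := h ▸ Finset.mem_insert_self _ _
    have hb : b ∈ ({c, e} : Finset (Fin k)) := h ▸ by simp
    simp only [Finset.mem_insert, Finset.mem_singleton] at ha hb
    have := hx.1
    have := hy.1
    rcases ha with rfl | rfl <;> rcases hb with rfl | rfl
    · omega
    · rfl
    · omega
    · omega
  have hdisj : Disjoint ({a, b} : Finset (Fin k)) {c, e} :=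
    ρ.toFinpartition.disjoint (ρ.blue_subset hx.2) (ρ.blue_subset hy.2) hset
  refine Equiv.Perm.Disjoint.commute (Equiv.Perm.disjoint_iff_disjoint_support.2 ?_)
  rw [Equiv.Perm.support_swap hx.1.ne, Equiv.Perm.support_swap hy.1.ne]
  exact hdisj

/-- The product of the transpositions `(a, b)` over the blue pairs `{a, b}`. -/
def sigmaBlue : Equiv.Perm (Fin k) :=
  ρ.bluePairs.noncommProd (fun x => Equiv.swap x.1 x.2) ρ.pairwise_commute

end BicolouredPairPartition

end StarCLT

end

/-! The moments of `cltLaw W n` are computed asymptotically, and the method of moments then gives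
weak convergence.

By multilinearity, the `k`-th moment is `n^(-k/2)` times the sum, over all words `j` in the letters
`1, …, n`, of the expectation of `ctr W (j 1) ⋯ ctr W (j k)` in the state of `ket W 1`. Words are
grouped by the partition of their places into blocks of equal letters. Conjugation by a permutation
fixing the point `0` is implemented by an isometry which fixes `ket W 1`, permutes the operators `U
W (gam n)` and commutes with `A₀ W`. A letter `U W (gam m)` whose point occurs nowhere else may
therefore be averaged over many points, which turns it into `A₀ W` (`inner_mul_U_gam_mul`). So a
word with a singleton block has expectation `0`. Partitions without singletons that are not pairings
have fewer than `k/2` blocks, hence too few words to matter, as every expectation is bounded by `2 ^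
k`. Each pairing has about `n^(k/2)` words, all with the same expectation.

For a pair of places, the expansion of `(U - A₀) ⋯ (U - A₀)` collapses to `U ⋯ U - A₀ ⋯ A₀`, since
both mixed terms equal the last one. The choice of `U` is the colour blue, that of `A₀` the colour
red with its sign (`wordState_ctr_eq_sum_mixedWord`). Replacing every `A₀` by a letter in a fresh
point leaves a word in star-transpositions, whose expectation is a value of `χ`.

That value comes from `chi_eq_sum`: `χ(σ)` is the total weight of the colourings of the points
invariant under `σ`. Following the colour of the image of the point `0` along the partial products
of the word gives a closed path `i` in the set of colours. Invariance of the colouring amounts to `i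
∘ η_k = i ∘ σ_blue`, and the colouring is determined by `i` on the points that occur
(`chi_star_word`).

Finally, the limit moments are at most `(2d)^k k!`. This growth makes a measure determined by its
moments, and bounded second moments give tightness (`exists_tendsto_of_moment`). -/

open scoped CompactlySupported

noncomputable section

/-! ### The method of moments on the real line -/

namespace MomentMethod

open ProbabilityTheory

/-- Moments growing at most like `C ^ k * k!` force exponential integrability near `0`. -/
theorem integrable_exp_mul_of_moment_le {μ : Measure ℝ} {C : ℝ} (hC : 0 < C)
    (hint : ∀ k, Integrable (fun t : ℝ => t ^ k) μ)
    (hle : ∀ k : ℕ, ∫ t : ℝ, t ^ k ∂μ ≤ C ^ k * k.factorial) {s : ℝ} (hs : |s| ≤ (2 * C)⁻¹) :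
    Integrable (fun t : ℝ => Real.exp (s * t)) μ := by
  have hnn : ∀ (k : ℕ) (t : ℝ), 0 ≤ (s * t) ^ (2 * k) / (2 * k).factorial := fun k t =>
    div_nonneg ((even_two_mul k).pow_nonneg _) (by positivity)
  have hfin : ∫⁻ t : ℝ, ENNReal.ofReal (Real.cosh (s * t)) ∂μ < ⊤ := by
    have e : ∀ t : ℝ, ENNReal.ofReal (Real.cosh (s * t)) =
        ∑' k : ℕ, ENNReal.ofReal ((s * t) ^ (2 * k) / (2 * k).factorial) := fun t => by
      -- `cosh` instead of `exp`: its series has only even powers, so all terms are nonnegative and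
      -- may be integrated one by one.
      rw [Real.cosh_eq_tsum, ENNReal.ofReal_tsum_of_nonneg (fun k => hnn k t)
        (Real.hasSum_cosh _).summable]
    simp_rw [e]
    rw [lintegral_tsum fun k => by fun_prop]
    have hb : ∀ k : ℕ, ∫⁻ t : ℝ, ENNReal.ofReal ((s * t) ^ (2 * k) / (2 * k).factorial) ∂μ ≤
        ENNReal.ofReal ((1 / 4) ^ k) := fun k => by
      have hi : Integrable (fun t : ℝ => (s * t) ^ (2 * k) / (2 * k).factorial) μ := by
        simp_rw [mul_pow]
        exact ((hint (2 * k)).const_mul _).div_const _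
      rw [← ofReal_integral_eq_lintegral_ofReal hi (.of_forall fun t => hnn k t)]
      refine ENNReal.ofReal_le_ofReal ?_
      simp_rw [mul_pow]
      rw [integral_div, integral_const_mul, div_le_iff₀ (by positivity)]
      -- The factorials cancel, and `|s| ≤ 1 / (2C)` leaves the geometric bound `4 ^ (-k)`.
      have h1 : s ^ (2 * k) ≤ ((2 * C)⁻¹) ^ (2 * k) := by
        rw [← (even_two_mul k).pow_abs]
        exact pow_le_pow_left₀ (abs_nonneg _) hs _
      calc s ^ (2 * k) * ∫ t : ℝ, t ^ (2 * k) ∂μ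
          ≤ ((2 * C)⁻¹) ^ (2 * k) * (C ^ (2 * k) * (2 * k).factorial) :=
            mul_le_mul h1 (hle _) (integral_nonneg fun t => (even_two_mul k).pow_nonneg _)
              (by positivity)
        _ = _ := by
          rw [mul_inv, mul_pow, pow_mul (2⁻¹ : ℝ), inv_pow C]
          field_simp
          norm_num
    refine (ENNReal.tsum_le_tsum hb).trans_lt ?_
    rw [← ENNReal.ofReal_tsum_of_nonneg (fun k => by positivity)
      (summable_geometric_of_lt_one (by norm_num) (by norm_num))]
    exact ENNReal.ofReal_lt_top
  have hcosh : Integrable (fun t : ℝ => Real.cosh (s * t)) μ :=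
    ⟨by fun_prop, by
      rw [hasFiniteIntegral_iff_ofReal (.of_forall fun t => (Real.cosh_pos _).le)]; exact hfin⟩
  refine (hcosh.const_mul 2).mono' (by fun_prop) (.of_forall fun t => ?_)
  rw [Real.norm_of_nonneg (Real.exp_pos _).le, Real.cosh_eq]
  have := Real.exp_pos (-(s * t))
  linarith

theorem zero_mem_interior_integrableExpSet {μ : Measure ℝ} {C : ℝ} (hC : 0 < C)
    (hint : ∀ k, Integrable (fun t : ℝ => t ^ k) μ)
    (hle : ∀ k : ℕ, ∫ t : ℝ, t ^ k ∂μ ≤ C ^ k * k.factorial) :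
    0 ∈ interior (integrableExpSet id μ) := by
  rw [mem_interior_iff_mem_nhds]
  filter_upwards [Metric.closedBall_mem_nhds (0 : ℝ) (ε := (2 * C)⁻¹) (by positivity)] with s hs
  exact integrable_exp_mul_of_moment_le hC hint hle (by simpa using hs)

/-- A probability measure on `ℝ` whose moments grow at most like `C ^ k * k!` is determined by
its moments. -/
theorem ext_of_moment_eq {μ ν : Measure ℝ} [IsProbabilityMeasure μ] [IsProbabilityMeasure ν]
    {C : ℝ} (hC : 0 < C) (hμ : ∀ k, Integrable (fun t : ℝ => t ^ k) μ)
    (hν : ∀ k, Integrable (fun t : ℝ => t ^ k) ν)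
    (hle : ∀ k : ℕ, ∫ t : ℝ, t ^ k ∂μ ≤ C ^ k * k.factorial)
    (heq : ∀ k : ℕ, ∫ t : ℝ, t ^ k ∂μ = ∫ t : ℝ, t ^ k ∂ν) : μ = ν := by
  have h0μ := zero_mem_interior_integrableExpSet hC hμ hle
  have h0ν := zero_mem_interior_integrableExpSet hC hν (fun k => (heq k) ▸ hle k)
  have pμ := (hasFPowerSeriesAt_mgf h0μ).eventually_hasSum_sub
  have pν := (hasFPowerSeriesAt_mgf h0ν).eventually_hasSum_sub
  -- The coefficients of both power series at `0` are given by the moments.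
  have hev : ∀ᶠ t : ℝ in 𝓝 0, mgf id μ t = mgf id ν t := by
    filter_upwards [pμ, pν] with t h1 h2
    simp only [id, zero_mul, Real.exp_zero, mul_one, heq] at h1 h2
    exact h1.unique h2
  let I := interior (integrableExpSet id μ) ∩ interior (integrableExpSet id ν)
  have hIc : Convex ℝ I :=
    convex_integrableExpSet.interior.inter convex_integrableExpSet.interior
  -- Identity theorem on a vertical strip, which is convex and contains the imaginary axis; on that
  -- axis the values are those of the characteristic functions.
  have hEq : Set.EqOn (complexMGF id μ) (complexMGF id ν) {z | z.re ∈ I} := by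
    refine AnalyticOnNhd.eqOn_of_preconnected_of_frequently_eq
      (analyticOnNhd_complexMGF.mono fun z hz => hz.1)
      (analyticOnNhd_complexMGF.mono fun z hz => hz.2)
      (hIc.linear_preimage Complex.reLm).isPreconnected (z₀ := ((0 : ℝ) : ℂ))
      ⟨by simpa using h0μ, by simpa using h0ν⟩ ?_
    have h_real : ∃ᶠ x : ℝ in 𝓝[≠] 0, complexMGF id μ x = complexMGF id ν x := by
      refine Eventually.frequently ?_
      filter_upwards [nhdsWithin_le_nhds hev] with y hy
      rw [complexMGF_ofReal, complexMGF_ofReal, hy]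
    rw [frequently_iff_seq_forall] at h_real ⊢
    obtain ⟨xs, hx_tendsto, hx_eq⟩ := h_real
    refine ⟨fun n => xs n, ?_, fun n => by simp [hx_eq]⟩
    rw [tendsto_nhdsWithin_iff] at hx_tendsto ⊢
    exact ⟨(Complex.continuous_ofReal.tendsto _).comp hx_tendsto.1, by simpa using hx_tendsto.2⟩
  refine Measure.ext_of_charFun (funext fun t => ?_)
  rw [← complexMGF_id_mul_I, ← complexMGF_id_mul_I]
  exact hEq ⟨by simpa using h0μ, by simpa using h0ν⟩

/-- The truncation of `t ^ k` to `[-R, R]`, as a bounded continuous function of `t`. -/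
def truncPow (k : ℕ) (R : ℝ) : BoundedContinuousFunction ℝ ℝ :=
  .ofNormedAddCommGroup (fun t => max (-R) (min R (t ^ k))) (by fun_prop) |R| fun t => by
    rw [Real.norm_eq_abs, abs_le]
    constructor
    · exact (neg_le_neg (le_abs_self R)).trans (le_max_left _ _)
    · exact max_le (neg_le_abs R) ((min_le_left _ _).trans (le_abs_self R))

theorem truncPow_apply (k : ℕ) (R t : ℝ) : truncPow k R t = max (-R) (min R (t ^ k)) := rfl

/-- With `y = t ^ k`, the error vanishes for `|y| ≤ R`; otherwise it is `|y| - R`, which is at most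
`y ^ 2 / R`. -/
theorem abs_sub_truncPow_le (k : ℕ) {R : ℝ} (hR : 0 < R) (t : ℝ) :
    |t ^ k - truncPow k R t| ≤ t ^ (2 * k) / R := by
  rw [truncPow_apply, mul_comm 2 k, pow_mul]
  generalize t ^ k = y
  rw [le_div_iff₀ hR]
  rcases le_total y R with h1 | h1
  · rw [min_eq_right h1]
    rcases le_total (-R) y with h2 | h2
    · rw [max_eq_right h2]; simp; positivity
    · rw [max_eq_left h2, abs_of_nonpos (by linarith)]; nlinarith [sq_nonneg (y + R)]
  · rw [min_eq_left h1, max_eq_right (by linarith), abs_of_nonneg (by linarith)]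
    nlinarith [sq_nonneg (y - R)]

variable {ι : Type*} {l : Filter ι} {μs : ι → ProbabilityMeasure ℝ} {μ : ProbabilityMeasure ℝ}

/-- Even moments which stay bounded along a weakly convergent family are finite in the limit. -/
theorem integrable_pow_of_tendsto [l.NeBot] (h : Tendsto μs l (𝓝 μ)) (k : ℕ) {K : ℝ}
    (hint : ∀ i, Integrable (fun t : ℝ => t ^ (2 * k)) (μs i : Measure ℝ))
    (hK : ∀ᶠ i in l, ∫ t : ℝ, t ^ (2 * k) ∂(μs i : Measure ℝ) ≤ K) :
    Integrable (fun t : ℝ => t ^ (2 * k)) (μ : Measure ℝ) ∧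
      ∫ t : ℝ, t ^ (2 * k) ∂(μ : Measure ℝ) ≤ K := by
  have hnn : ∀ t : ℝ, 0 ≤ t ^ (2 * k) := fun t => (even_two_mul k).pow_nonneg t
  have hlt : ∀ n : ℕ, ∫ t, truncPow (2 * k) n t ∂(μ : Measure ℝ) ≤ K := fun n => by
    refine le_of_tendsto
      (ProbabilityMeasure.tendsto_iff_forall_integral_tendsto.1 h (truncPow (2 * k) n)) ?_
    filter_upwards [hK] with i hi
    refine (integral_mono ((truncPow (2 * k) n).integrable _) (hint i) fun t => ?_).trans hi
    exact max_le (by have := hnn t; have : (0 : ℝ) ≤ n := by positivity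
                     simp only; linarith) (min_le_right _ _)
  have htn : ∀ (n : ℕ) (t : ℝ), 0 ≤ truncPow (2 * k) n t := fun n t =>
    le_max_of_le_right (le_min (by positivity) (hnn t))
  have hlim : ∀ t : ℝ, Tendsto (fun n : ℕ => ENNReal.ofReal (truncPow (2 * k) n t)) atTop
      (𝓝 (ENNReal.ofReal (t ^ (2 * k)))) := fun t => by
    refine tendsto_const_nhds.congr' ?_
    filter_upwards [eventually_ge_atTop ⌈t ^ (2 * k)⌉₊] with n hn
    have hn' : t ^ (2 * k) ≤ n := (Nat.le_ceil _).trans (by exact_mod_cast hn)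
    rw [truncPow_apply, min_eq_right hn', max_eq_right]
    have := hnn t
    have : (0 : ℝ) ≤ n := by positivity
    linarith
  -- Fatou's lemma along the truncations, which are eventually equal to `t ^ (2 * k)` at each point.
  have hl : ∫⁻ t : ℝ, ENNReal.ofReal (t ^ (2 * k)) ∂(μ : Measure ℝ) ≤ ENNReal.ofReal K := by
    calc ∫⁻ t : ℝ, ENNReal.ofReal (t ^ (2 * k)) ∂(μ : Measure ℝ)
        = ∫⁻ t : ℝ, liminf (fun n : ℕ => ENNReal.ofReal (truncPow (2 * k) n t)) atTop
            ∂(μ : Measure ℝ) := lintegral_congr fun t => (hlim t).liminf_eq.symm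
      _ ≤ liminf (fun n : ℕ => ∫⁻ t : ℝ, ENNReal.ofReal (truncPow (2 * k) n t) ∂(μ : Measure ℝ))
            atTop := lintegral_liminf_le fun n => by fun_prop
      _ ≤ ENNReal.ofReal K := by
        refine liminf_le_of_le (by isBoundedDefault) fun b hb => ?_
        obtain ⟨n, hn⟩ := hb.exists
        refine hn.trans ?_
        rw [← ofReal_integral_eq_lintegral_ofReal ((truncPow (2 * k) n).integrable _)
          (.of_forall (htn n))]
        exact ENNReal.ofReal_le_ofReal (hlt n)
  have hi : Integrable (fun t : ℝ => t ^ (2 * k)) (μ : Measure ℝ) :=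
    ⟨by fun_prop, by
      rw [hasFiniteIntegral_iff_ofReal (.of_forall hnn)]; exact hl.trans_lt ENNReal.ofReal_lt_top⟩
  refine ⟨hi, ?_⟩
  have hK0 : 0 ≤ K := by
    obtain ⟨i, hi⟩ := hK.exists
    exact (integral_nonneg hnn).trans hi
  rw [← ofReal_integral_eq_lintegral_ofReal hi (.of_forall hnn)] at hl
  exact (ENNReal.ofReal_le_ofReal_iff hK0).1 hl

theorem integrable_pow_of_integrable_pow_two_mul {μ : Measure ℝ} [IsFiniteMeasure μ] {k : ℕ}
    (h : Integrable (fun t : ℝ => t ^ (2 * k)) μ) : Integrable (fun t : ℝ => t ^ k) μ := by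
  refine (h.add (integrable_const (1 : ℝ))).mono' (by fun_prop) (.of_forall fun t => ?_)
  simp only [Pi.add_apply]
  rw [mul_comm 2 k, pow_mul, Real.norm_eq_abs, ← sq_abs]
  nlinarith [sq_nonneg (|t ^ k| - 1), abs_nonneg (t ^ k)]

/-- The truncation error is controlled by the moment of order `2k` alone, hence uniformly along a
family with bounded moments of that order. -/
theorem abs_integral_pow_sub_truncPow_le {μ : Measure ℝ} [IsFiniteMeasure μ] {k : ℕ}
    (h : Integrable (fun t : ℝ => t ^ (2 * k)) μ) {R : ℝ} (hR : 0 < R) :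
    |∫ t : ℝ, t ^ k ∂μ - ∫ t : ℝ, truncPow k R t ∂μ| ≤ (∫ t : ℝ, t ^ (2 * k) ∂μ) / R := by
  rw [← integral_sub (integrable_pow_of_integrable_pow_two_mul h) ((truncPow k R).integrable _),
    ← integral_div]
  refine (abs_integral_le_integral_abs).trans (integral_mono_of_nonneg
    (.of_forall fun t => abs_nonneg _) (h.div_const R) (.of_forall fun t => ?_))
  exact abs_sub_truncPow_le k hR t

/-- Moments converge along weakly convergent families with bounded higher moments. -/
theorem tendsto_moment [l.NeBot] (h : Tendsto μs l (𝓝 μ)) (k : ℕ) {K : ℝ}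
    (hint : ∀ i, Integrable (fun t : ℝ => t ^ (2 * k)) (μs i : Measure ℝ))
    (hK : ∀ᶠ i in l, ∫ t : ℝ, t ^ (2 * k) ∂(μs i : Measure ℝ) ≤ K) :
    Tendsto (fun i => ∫ t : ℝ, t ^ k ∂(μs i : Measure ℝ)) l
      (𝓝 (∫ t : ℝ, t ^ k ∂(μ : Measure ℝ))) := by
  obtain ⟨hi, hiK⟩ := integrable_pow_of_tendsto h k hint hK
  rw [Metric.tendsto_nhds]
  intro ε hε
  obtain ⟨R, hR0, hR⟩ : ∃ R : ℝ, 0 < R ∧ K / R < ε / 3 := by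
    have hlim : Tendsto (fun R : ℝ => K / R) atTop (𝓝 0) := tendsto_const_nhds.div_atTop tendsto_id
    exact ((eventually_gt_atTop 0).and (hlim.eventually_lt_const (by positivity))).exists
  have h1 := Metric.tendsto_nhds.1
    (ProbabilityMeasure.tendsto_iff_forall_integral_tendsto.1 h (truncPow k R)) (ε / 3)
    (by positivity)
  filter_upwards [hK, h1] with i hiK' hi1
  have a1 := (abs_integral_pow_sub_truncPow_le (hint i) hR0).trans
    (div_le_div_of_nonneg_right hiK' hR0.le)
  have a2 := (abs_integral_pow_sub_truncPow_le hi hR0).trans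
    (div_le_div_of_nonneg_right hiK hR0.le)
  rw [Real.dist_eq] at hi1 ⊢
  rw [abs_le] at a1 a2
  rw [abs_lt] at hi1 ⊢
  constructor <;> linarith

/-- The method of moments, for limit moments growing at most like `C ^ k * k!`. -/
theorem exists_tendsto_of_moment {μs : ℕ → ProbabilityMeasure ℝ} {m : ℕ → ℝ} {C : ℝ} (hC : 0 < C)
    (hint : ∀ n k, Integrable (fun t : ℝ => t ^ k) (μs n : Measure ℝ))
    (hlim : ∀ k, Tendsto (fun n => ∫ t : ℝ, t ^ k ∂(μs n : Measure ℝ)) atTop (𝓝 (m k)))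
    (hm : ∀ k : ℕ, m k ≤ C ^ k * k.factorial) :
    ∃ μ : ProbabilityMeasure ℝ, Tendsto μs atTop (𝓝 μ) ∧
      ∀ k, Integrable (fun t : ℝ => t ^ k) (μ : Measure ℝ) ∧
        ∫ t : ℝ, t ^ k ∂(μ : Measure ℝ) = m k := by
  have hbdd : ∀ k, ∃ K, ∀ n, ∫ t : ℝ, t ^ k ∂(μs n : Measure ℝ) ≤ K := fun k => by
    obtain ⟨K, hK⟩ := (hlim k).bddAbove_range
    exact ⟨K, fun n => hK ⟨n, rfl⟩⟩
  -- Chebyshev's inequality with the second moment.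
  have htight : IsTightMeasureSet
      {((μ : ProbabilityMeasure ℝ) : Measure ℝ) | μ ∈ Set.range μs} := by
    obtain ⟨K, hK⟩ := hbdd 2
    refine isTightMeasureSet_of_tendsto_measure_norm_gt ?_
    have hz : Tendsto (fun r : ℝ => ENNReal.ofReal (K / r ^ 2)) atTop (𝓝 0) := by
      rw [← ENNReal.ofReal_zero]
      exact ENNReal.tendsto_ofReal
        (tendsto_const_nhds.div_atTop (tendsto_pow_atTop (two_ne_zero)))
    refine tendsto_of_tendsto_of_tendsto_of_le_of_le' tendsto_const_nhds hz
      (.of_forall fun _ => zero_le) ?_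
    filter_upwards [eventually_gt_atTop 0] with r hr
    refine iSup₂_le ?_
    rintro _ ⟨_, ⟨n, rfl⟩, rfl⟩
    have hmk := mul_meas_ge_le_integral_of_nonneg (μ := (μs n : Measure ℝ))
      (f := fun t : ℝ => t ^ 2) (.of_forall fun t => sq_nonneg t) (hint n 2) (r ^ 2)
    rw [← ofReal_measureReal (measure_ne_top _ _)]
    refine ENNReal.ofReal_le_ofReal ?_
    rw [le_div_iff₀ (by positivity), mul_comm]
    refine le_trans ?_ (hmk.trans (hK n))
    refine mul_le_mul_of_nonneg_left (measureReal_mono fun t ht => ?_) (by positivity)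
    have ht' : r < |t| := ht
    change r ^ 2 ≤ t ^ 2
    rw [← sq_abs t]
    gcongr
  have hcomp := isCompact_closure_of_isTightMeasureSet htight
  -- Stated for an arbitrary filter below `atTop`, so as to apply to the ultrafilters that realise
  -- cluster points.
  have hev : ∀ (F : Filter ℕ) (ν : ProbabilityMeasure ℝ), F.NeBot → F ≤ atTop →
      Tendsto μs F (𝓝 ν) → ∀ k, Integrable (fun t : ℝ => t ^ k) (ν : Measure ℝ) ∧
        ∫ t : ℝ, t ^ k ∂(ν : Measure ℝ) = m k := by
    intro F ν hF hle hν k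
    obtain ⟨K, hK⟩ := hbdd (2 * k)
    refine ⟨integrable_pow_of_integrable_pow_two_mul
      (integrable_pow_of_tendsto hν k (fun n => hint n _) (.of_forall hK)).1, ?_⟩
    exact tendsto_nhds_unique (tendsto_moment hν k (fun n => hint n _) (.of_forall hK))
      ((hlim k).mono_left hle)
  have hmem : ∀ n, μs n ∈ closure (Set.range μs) := fun n => subset_closure ⟨n, rfl⟩
  obtain ⟨μ, -, hμ⟩ := hcomp.exists_mapClusterPt (f := atTop) (u := μs)
    (by rw [le_principal_iff]; exact Filter.mem_map.2 (Eventually.of_forall hmem))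
  obtain ⟨u, hu, huμ⟩ := mapClusterPt_iff_ultrafilter.1 hμ
  have hμm := hev u μ u.neBot hu huμ
  -- In a compact set, a sequence with a single cluster point converges; any two cluster points have
  -- the same moments.
  refine ⟨μ, hcomp.tendsto_nhds_of_unique_mapClusterPt (.of_forall hmem) fun ν _ hν => ?_, hμm⟩
  obtain ⟨v, hv, hvν⟩ := mapClusterPt_iff_ultrafilter.1 hν
  have hνm := hev v ν v.neBot hv hvν
  have h : (ν : Measure ℝ) = μ := ext_of_moment_eq hC (fun k => (hνm k).1) (fun k => (hμm k).1)
    (fun k => (hνm k).2 ▸ hm k) fun k => by rw [(hνm k).2, (hμm k).2]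
  exact Subtype.ext h

end MomentMethod

/-! ### Moments of the law of a bounded selfadjoint operator -/

namespace StarCLT

variable {H : Type} [NormedAddCommGroup H] [InnerProductSpace ℂ H] [CompleteSpace H]

/-- The law of `T` is carried by `[-‖T‖ - 1, ‖T‖ + 1]`. -/
theorem ae_law_mem_closedBall (T : selfAdjoint (H →L[ℂ] H)) (ξ : H) (hξ : ‖ξ‖ = 1) :
    ∀ᵐ t ∂(law T ξ hξ : Measure ℝ), t ∈ Metric.closedBall (0 : ℝ) (‖(T : H →L[ℂ] H)‖ + 1) := by
  set r := ‖(T : H →L[ℂ] H)‖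
  -- The bump is `1` on a ball containing the spectrum, so the functional calculus sends it to `1`
  -- and its integral is `1`. Being at most `1`, it equals `1` almost everywhere, and it vanishes
  -- off the ball of radius `r + 1`.
  obtain ⟨f, h1, h0, h2, h3⟩ := exists_continuous_one_zero_of_isCompact (X := ℝ)
    (isCompact_closedBall (0 : ℝ) r) (t := (Metric.ball (0 : ℝ) (r + 1))ᶜ)
    (Metric.isOpen_ball.isClosed_compl)
    (Set.disjoint_compl_right_iff_subset.2 (Metric.closedBall_subset_ball (by linarith)))
  let F : C_c(ℝ, ℝ) := ⟨f, h2⟩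
  have hcfc : cfc (F : ℝ → ℝ) (T : H →L[ℂ] H) = 1 := by
    have : Nontrivial H := ⟨ξ, 0, fun h => by simp [h] at hξ⟩
    rw [← cfc_one ℝ (T : H →L[ℂ] H) T.2]
    refine cfc_congr fun x hx => h1 ?_
    simpa using spectrum.norm_le_norm_of_mem hx
  have hsupp : tsupport F ⊆ Metric.closedBall (0 : ℝ) (r + 1) := by
    refine closure_minimal (fun x hx => ?_) Metric.isClosed_closedBall
    by_contra hc
    exact hx (h0 fun hb => hc (Metric.ball_subset_closedBall hb))
  have hint := integral_lawMeasure T ξ F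
  rw [hcfc] at hint
  simp only [one_apply_eq_self, inner_self_eq_norm_sq_to_K, hξ] at hint
  have hint' : ∫ t, F t ∂(law T ξ hξ : Measure ℝ) = 1 := by
    rw [show (law T ξ hξ : Measure ℝ) = lawMeasure T ξ from rfl, hint]; norm_num
  have hFi : Integrable F (law T ξ hξ : Measure ℝ) :=
    F.continuous.integrable_of_hasCompactSupport h2
  have h10 : ∫ t, (1 - F t) ∂(law T ξ hξ : Measure ℝ) = 0 := by
    rw [integral_sub (integrable_const _) hFi, hint']; simp
  have hae := (integral_eq_zero_iff_of_nonneg (fun t => sub_nonneg.2 (h3 t).2)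
    ((integrable_const _).sub hFi)).1 h10
  filter_upwards [hae] with t ht
  refine hsupp (subset_tsupport _ ?_)
  have : F t = 1 := by simp only [Pi.zero_apply] at ht; change f t = 1; linarith
  simp [this]

theorem integrable_pow_law (T : selfAdjoint (H →L[ℂ] H)) (ξ : H) (hξ : ‖ξ‖ = 1) (k : ℕ) :
    Integrable (fun t : ℝ => t ^ k) (law T ξ hξ : Measure ℝ) := by
  refine (integrable_const ((‖(T : H →L[ℂ] H)‖ + 1) ^ k)).mono' (by fun_prop) ?_
  filter_upwards [ae_law_mem_closedBall T ξ hξ] with t ht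
  rw [norm_pow]
  gcongr
  simpa using ht

/-- The moments of the law of `T` in the vector state of `ξ`. -/
theorem integral_pow_law (T : selfAdjoint (H →L[ℂ] H)) (ξ : H) (hξ : ‖ξ‖ = 1) (k : ℕ) :
    ∫ t : ℝ, t ^ k ∂(law T ξ hξ : Measure ℝ) = (⟪ξ, ((T : H →L[ℂ] H) ^ k) ξ⟫_ℂ).re := by
  have : Nontrivial H := ⟨ξ, 0, fun h => by simp [h] at hξ⟩
  obtain ⟨p, -, hp⟩ := exists_plateau (‖(T : H →L[ℂ] H)‖ + 1)
  -- A compactly supported function which agrees with `t ^ k` on the spectrum and almost everywhere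
  -- for the law.
  let F : C_c(ℝ, ℝ) := ⟨⟨fun t => t ^ k * p t, by fun_prop⟩, p.hasCompactSupport.mul_left⟩
  have e1 : ∫ t : ℝ, t ^ k ∂(law T ξ hξ : Measure ℝ) = ∫ t, F t ∂(lawMeasure T ξ) := by
    refine integral_congr_ae ?_
    filter_upwards [ae_law_mem_closedBall T ξ hξ] with t ht
    change t ^ k = t ^ k * p t
    rw [hp t ht, mul_one]
  have e2 : cfc (F : ℝ → ℝ) (T : H →L[ℂ] H) = (T : H →L[ℂ] H) ^ k := by
    rw [← cfc_pow_id (R := ℝ) (T : H →L[ℂ] H) k T.2]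
    refine cfc_congr fun x hx => ?_
    change x ^ k * p x = x ^ k
    rw [hp x, mul_one]
    have := spectrum.norm_le_norm_of_mem hx
    simp only [Metric.mem_closedBall, dist_zero_right]
    linarith
  rw [e1, integral_lawMeasure, e2]

end StarCLT

/-! ### Exchangeability of the star-transpositions -/

namespace StarCLT

variable {d : ℕ} (W : Weights d)

/-- Holds because `χ` is a class function; it makes conjugation an isometry. -/
theorem preInner_mapDomain_conj (τ : FinPerm) (f g : FinPerm →₀ ℂ) :
    preInner W (f.mapDomain fun σ => τ * σ * τ⁻¹) (g.mapDomain fun σ => τ * σ * τ⁻¹) =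
      preInner W f g := by
  unfold preInner
  rw [Finsupp.sum_mapDomain_index (by simp) (by simp [← Finsupp.sum_add, add_mul])]
  refine Finsupp.sum_congr fun σ _ => ?_
  rw [Finsupp.sum_mapDomain_index (by simp) (by simp [mul_add, add_mul])]
  refine Finsupp.sum_congr fun σ' _ => ?_
  rw [← chi_conj W τ (σ * σ'⁻¹)]
  have : τ * σ * τ⁻¹ * (τ * σ' * τ⁻¹)⁻¹ = τ * (σ * σ'⁻¹) * τ⁻¹ := by group
  rw [this]

/-- Conjugation by `τ` before completion. -/
def preConj (τ : FinPerm) : PreGNS W →ₗ[ℂ] PreGNS W :=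
  Finsupp.lmapDomain ℂ ℂ (fun σ => τ * σ * τ⁻¹)

theorem preInner_preConj (τ : FinPerm) (f g : PreGNS W) :
    ⟪preConj W τ f, preConj W τ g⟫_ℂ = ⟪f, g⟫_ℂ := preInner_mapDomain_conj W τ f g

/-- The isometry of `H` with `σ̂ ↦ (τ σ τ⁻¹)^`. -/
def conjOp (τ : FinPerm) : GNS W →L[ℂ] GNS W :=
  ((preConj W τ).isometryOfInner (preInner_preConj W τ)).toContinuousLinearMap.completion

theorem conjOp_ket (τ σ : FinPerm) : conjOp W τ (ket W σ) = ket W (τ * σ * τ⁻¹) := by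
  unfold conjOp ket
  rw [ContinuousLinearMap.completion_apply_coe]
  congr 1
  exact Finsupp.mapDomain_single

theorem conjOp_ket_one (τ : FinPerm) : conjOp W τ (ket W 1) = ket W 1 := by
  rw [conjOp_ket]; simp

theorem inner_conjOp (τ : FinPerm) (ξ η : GNS W) :
    ⟪conjOp W τ ξ, conjOp W τ η⟫_ℂ = ⟪ξ, η⟫_ℂ := by
  induction ξ, η using UniformSpace.Completion.induction_on₂ with
  | hp => exact isClosed_eq (by fun_prop) (by fun_prop)
  | ih f g =>
    unfold conjOp
    rw [ContinuousLinearMap.completion_apply_coe, ContinuousLinearMap.completion_apply_coe,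
      UniformSpace.Completion.inner_coe, UniformSpace.Completion.inner_coe]
    exact preInner_preConj W τ f g

theorem conjOp_mul_U (τ σ : FinPerm) :
    conjOp W τ * U W σ = U W (τ * σ * τ⁻¹) * conjOp W τ :=
  clm_ext W fun ρ => by
    change conjOp W τ (U W σ (ket W ρ)) = U W (τ * σ * τ⁻¹) (conjOp W τ (ket W ρ))
    rw [U_ket, conjOp_ket, conjOp_ket, U_ket]
    congr 1
    group

theorem conj_gam {τ : FinPerm} (h0 : (τ : Equiv.Perm ℕ) 0 = 0) (n : ℕ) :
    τ * gam n * τ⁻¹ = gam ((τ : Equiv.Perm ℕ) n) := by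
  refine Subtype.ext ?_
  change (τ : Equiv.Perm ℕ) * Equiv.swap 0 n * (τ : Equiv.Perm ℕ)⁻¹ = Equiv.swap 0 _
  rw [← Equiv.swap_apply_apply, h0]

/-- Once `n` exceeds the support of `τ`, conjugation by `τ` merely permutes the summands of `avg W
n`; the relation passes to the strong limit. -/
theorem conjOp_mul_A₀ {τ : FinPerm} (h0 : (τ : Equiv.Perm ℕ) 0 = 0) :
    conjOp W τ * A₀ W = A₀ W * conjOp W τ := by
  refine ContinuousLinearMap.ext fun ξ => ?_
  have h1 : Tendsto (fun n => conjOp W τ (avg W n ξ)) atTop (𝓝 (conjOp W τ (A₀ W ξ))) :=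
    ((conjOp W τ).continuous.tendsto _).comp (tendsto_avg W ξ)
  refine tendsto_nhds_unique h1 ((tendsto_avg W (conjOp W τ ξ)).congr' ?_)
  obtain ⟨N, hN⟩ := exists_bound {τ}
  have hN := hN τ (by simp)
  filter_upwards [eventually_ge_atTop N] with n hn
  simp only [avg, smul_apply, sum_apply, map_smul, map_sum]
  congr 1
  have hmem : ∀ i, i ∈ Finset.Icc 1 n ↔ (τ : Equiv.Perm ℕ) i ∈ Finset.Icc 1 n := by
    intro i
    have a0 : (τ : Equiv.Perm ℕ) i = 0 ↔ i = 0 := by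
      constructor
      · intro h; exact (τ : Equiv.Perm ℕ).injective (h.trans h0.symm)
      · rintro rfl; exact h0
    have an : n < (τ : Equiv.Perm ℕ) i ↔ n < i := by
      constructor
      · intro h
        have := (τ : Equiv.Perm ℕ).injective (hN ((τ : Equiv.Perm ℕ) i) (by omega))
        omega
      · intro h; rw [hN i (by omega)]; exact h
    simp only [Finset.mem_Icc]
    omega
  refine Finset.sum_equiv (τ : Equiv.Perm ℕ).symm (fun i => ?_) fun i _ => ?_
  · rw [hmem ((τ : Equiv.Perm ℕ).symm i), Equiv.apply_symm_apply]
  · have := congrArg (fun A : GNS W →L[ℂ] GNS W => A ξ)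
      (conjOp_mul_U W τ (gam ((τ : Equiv.Perm ℕ).symm i)))
    simp only [conj_gam h0, Equiv.apply_symm_apply] at this
    exact this.symm

/-- Operators which are invariant under conjugation by the permutations fixing the points
of `F`. -/
def invariants (F : Set ℕ) : Submodule ℂ (GNS W →L[ℂ] GNS W) where
  carrier := {Z | ∀ τ : FinPerm, (∀ n ∈ F, (τ : Equiv.Perm ℕ) n = n) →
    conjOp W τ * Z = Z * conjOp W τ}
  add_mem' hA hB τ hτ := by rw [mul_add, add_mul, hA τ hτ, hB τ hτ]
  zero_mem' τ _ := by simp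
  smul_mem' c A hA τ hτ := by rw [mul_smul_comm, smul_mul_assoc, hA τ hτ]

variable {W}

theorem U_gam_mem_invariants {F : Set ℕ} (h0 : 0 ∈ F) {n : ℕ} (hn : n ∈ F) :
    U W (gam n) ∈ invariants W F := fun τ hτ => by
  rw [conjOp_mul_U, conj_gam (hτ 0 h0), hτ n hn]

theorem A₀_mem_invariants {F : Set ℕ} (h0 : 0 ∈ F) : A₀ W ∈ invariants W F := fun _ hτ =>
  conjOp_mul_A₀ W (hτ 0 h0)

theorem list_prod_mem_invariants {F : Set ℕ} (L : List (GNS W →L[ℂ] GNS W))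
    (hL : ∀ Z ∈ L, Z ∈ invariants W F) : L.prod ∈ invariants W F := by
  induction L with
  | nil => intro τ _; simp
  | cons Z L ih =>
    intro τ hτ
    rw [List.prod_cons, ← mul_assoc, hL Z (by simp) τ hτ, mul_assoc,
      ih (fun Y hY => hL Y (by simp [hY])) τ hτ, mul_assoc]

/-- `conjOp W τ` is isometric and fixes `ket W 1`, so intertwined operators have the same
expectation. -/
theorem inner_invariant {B : GNS W →L[ℂ] GNS W} {τ : FinPerm} {B' : GNS W →L[ℂ] GNS W}
    (h : conjOp W τ * B = B' * conjOp W τ) :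
    ⟪ket W 1, B (ket W 1)⟫_ℂ = ⟪ket W 1, B' (ket W 1)⟫_ℂ := by
  have h' : conjOp W τ (B (ket W 1)) = B' (conjOp W τ (ket W 1)) :=
    congrArg (fun A : GNS W →L[ℂ] GNS W => A (ket W 1)) h
  rw [conjOp_ket_one] at h'
  rw [← inner_conjOp W τ, conjOp_ket_one, h']

/-- The transposition of two points, as a finite permutation. -/
def finSwap (a b : ℕ) : FinPerm :=
  ⟨Equiv.swap a b, (Set.toFinite {a, b}).subset fun m hm => by
    by_contra h
    simp only [Set.mem_insert_iff, Set.mem_singleton_iff, not_or] at h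
    exact hm (Equiv.swap_apply_of_ne_of_ne h.1 h.2)⟩

/-- In a word all of whose other letters do not involve the point `m`, the letter `U(γ_m)` may be
replaced with `A_0`. -/
theorem inner_mul_U_gam_mul {F : Set ℕ} (hF : F.Finite) (h0 : 0 ∈ F) {m : ℕ} (hm : m ∉ F)
    {B C : GNS W →L[ℂ] GNS W} (hB : B ∈ invariants W F) (hC : C ∈ invariants W F) :
    ⟪ket W 1, (B * U W (gam m) * C) (ket W 1)⟫_ℂ = ⟪ket W 1, (B * A₀ W * C) (ket W 1)⟫_ℂ := by
  set c := ⟪ket W 1, (B * U W (gam m) * C) (ket W 1)⟫_ℂ with hc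
  have hm0 : m ≠ 0 := fun h => hm (h ▸ h0)
  -- The transposition of `n` and `m` turns one letter into the other and leaves `B` and `C` alone.
  have heq : ∀ n, n ∉ F → ⟪ket W 1, (B * U W (gam n) * C) (ket W 1)⟫_ℂ = c := by
    intro n hn
    have hn0 : n ≠ 0 := fun h => hn (h ▸ h0)
    have hfix : ∀ x ∈ F, (finSwap n m : Equiv.Perm ℕ) x = x := fun x hx =>
      Equiv.swap_apply_of_ne_of_ne (fun h => hn (h ▸ hx)) (fun h => hm (h ▸ hx))
    refine inner_invariant (τ := finSwap n m) ?_
    rw [← mul_assoc, ← mul_assoc, hB _ hfix, mul_assoc B, conjOp_mul_U, conj_gam (hfix 0 h0),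
      mul_assoc B, mul_assoc (U W _), hC _ hfix]
    simp [finSwap, mul_assoc]
  have hlim : Tendsto (fun n => ⟪ket W 1, (B * avg W n * C) (ket W 1)⟫_ℂ) atTop
      (𝓝 ⟪ket W 1, (B * A₀ W * C) (ket W 1)⟫_ℂ) :=
    tendsto_const_nhds.inner ((B.continuous.tendsto _).comp (tendsto_avg W (C (ket W 1))))
  have hev : Tendsto (fun n => ⟪ket W 1, (B * U W (gam (n + 1)) * C) (ket W 1)⟫_ℂ) atTop
      (𝓝 c) := by
    refine tendsto_const_nhds.congr' ?_
    obtain ⟨b, hb⟩ := hF.bddAbove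
    filter_upwards [eventually_ge_atTop b] with n hn
    refine (heq (n + 1) fun h => ?_).symm
    have := hb h
    omega
  -- The Cesàro means of an eventually constant sequence tend to the constant `c`; they are the
  -- expectations with `avg W n` in the middle.
  refine tendsto_nhds_unique (hev.cesaro_smul) (hlim.congr fun n => ?_)
  have : Finset.Icc 1 n = (Finset.range n).map ⟨(· + 1), add_left_injective 1⟩ := by
    ext x
    simp only [Finset.mem_Icc, Finset.mem_map, Finset.mem_range, Function.Embedding.coeFn_mk]
    exact ⟨fun h => ⟨x - 1, by omega, by omega⟩, by rintro ⟨y, h, rfl⟩; omega⟩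
  rw [avg, this, Finset.sum_map]
  simp only [Function.Embedding.coeFn_mk, mul_smul_comm, smul_mul_assoc, Finset.mul_sum,
    Finset.sum_mul, smul_apply, sum_apply, inner_smul_right, inner_sum]
  rw [Complex.real_smul]
  push_cast
  rw [Finset.mul_sum]

variable (W)

/-- The expectation of a word `Z_1 ⋯ Z_k` in the vector state of `ê`, as a multilinear map. -/
def wordState (k : ℕ) : MultilinearMap ℂ (fun _ : Fin k => GNS W →L[ℂ] GNS W) ℂ :=
  LinearMap.compMultilinearMap
    { toFun := fun B => ⟪ket W 1, B (ket W 1)⟫_ℂ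
      map_add' := fun A B => by simp [inner_add_right]
      map_smul' := fun c A => by simp [inner_smul_right] }
    (MultilinearMap.mkPiAlgebraFin ℂ k (GNS W →L[ℂ] GNS W))

variable {W}

theorem wordState_apply {k : ℕ} (Z : Fin k → GNS W →L[ℂ] GNS W) :
    wordState W k Z = ⟪ket W 1, (List.ofFn Z).prod (ket W 1)⟫_ℂ := rfl

theorem list_ofFn_update_prod {M : Type*} [Monoid M] {k : ℕ} (Z : Fin k → M) (p : Fin k) (a : M) :
    (List.ofFn (Function.update Z p a)).prod =
      ((List.ofFn Z).take p).prod * a * ((List.ofFn Z).drop (p + 1)).prod := by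
  have : List.ofFn (Function.update Z p a) = (List.ofFn Z).set p a := by
    refine List.ext_getElem (by simp) fun n h1 h2 => ?_
    simp only [List.getElem_ofFn, List.getElem_set, Function.update_apply, Fin.ext_iff]
    simp [eq_comm]
  rw [this, List.prod_set, if_pos (by simp)]

theorem wordState_update_U_gam {k : ℕ} {Z : Fin k → GNS W →L[ℂ] GNS W} {p : Fin k} {F : Set ℕ}
    (hF : F.Finite) (h0 : 0 ∈ F) {m : ℕ} (hm : m ∉ F) (hZ : ∀ l, l ≠ p → Z l ∈ invariants W F) :
    wordState W k (Function.update Z p (U W (gam m))) =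
      wordState W k (Function.update Z p (A₀ W)) := by
  -- Nothing is assumed about `Z p`. Emptying this slot to `0` makes every letter invariant, hence
  -- also the products before and after the slot.
  have hu : ∀ A, Function.update Z p A = Function.update (Function.update Z p 0) p A := by simp
  have hmem : ∀ Y ∈ List.ofFn (Function.update Z p 0), Y ∈ invariants W F := by
    intro Y hY
    obtain ⟨l, rfl⟩ := (List.mem_ofFn' _ _).1 hY
    by_cases h : l = p
    · subst h; simp
    · simpa [h] using hZ l h
  rw [hu, hu (A₀ W)]
  simp only [wordState_apply, list_ofFn_update_prod]
  exact inner_mul_U_gam_mul hF h0 hm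
    (list_prod_mem_invariants _ fun Y hY => hmem Y (List.mem_of_mem_take hY))
    (list_prod_mem_invariants _ fun Y hY => hmem Y (List.mem_of_mem_drop hY))

variable (W)

/-- The centred operators `U(γ_n) - A_0`. -/
def ctr (n : ℕ) : GNS W →L[ℂ] GNS W := U W (gam n) - A₀ W

variable {W}

theorem ctr_mem_invariants {F : Set ℕ} (h0 : 0 ∈ F) {n : ℕ} (hn : n ∈ F) :
    ctr W n ∈ invariants W F := sub_mem (U_gam_mem_invariants h0 hn) (A₀_mem_invariants h0)

/-- Words with a centred letter occurring only once have expectation `0`. -/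
theorem wordState_ctr_eq_zero {k : ℕ} {j : Fin k → ℕ} (hj : ∀ l, j l ≠ 0) {p : Fin k}
    (hp : ∀ l, j l = j p → l = p) : wordState W k (fun l => ctr W (j l)) = 0 := by
  have hu : (fun l => ctr W (j l)) =
      Function.update (fun l => ctr W (j l)) p (U W (gam (j p)) - A₀ W) := by
    rw [show U W (gam (j p)) - A₀ W = (fun l => ctr W (j l)) p from rfl, Function.update_eq_self]
  rw [hu, MultilinearMap.map_update_sub, sub_eq_zero]
  refine wordState_update_U_gam (F := insert 0 (j '' {l | l ≠ p})) (Set.toFinite _) (by simp)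
    ?_ fun l hl => ctr_mem_invariants (by simp) (by right; exact ⟨l, hl, rfl⟩)
  rintro (h | ⟨l, hl, h⟩)
  · exact hj p h
  · exact hl (hp l h)

theorem norm_U_le (σ : FinPerm) : ‖U W σ‖ ≤ 1 :=
  ContinuousLinearMap.opNorm_le_bound _ zero_le_one fun ξ => by rw [norm_U, one_mul]

theorem norm_A₀_le : ‖A₀ W‖ ≤ 1 :=
  ContinuousLinearMap.opNorm_le_bound _ zero_le_one fun ξ => by
    rw [one_mul]
    exact le_of_tendsto (tendsto_avg W ξ).norm (.of_forall fun n => norm_avg_le W n ξ)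

theorem norm_wordState_ctr_le {k : ℕ} (j : Fin k → ℕ) :
    ‖wordState W k (fun l => ctr W (j l))‖ ≤ 2 ^ k := by
  have h2 : ∀ n, ‖ctr W n‖ ≤ 2 := fun n =>
    (norm_sub_le _ _).trans (by linarith [norm_U_le (W := W) (gam n), norm_A₀_le (W := W)])
  have hL : ∀ L : List ℕ, ∀ ξ, ‖(L.map (ctr W)).prod ξ‖ ≤ 2 ^ L.length * ‖ξ‖ := by
    intro L
    induction L with
    | nil => intro ξ; simp
    | cons n L ih =>
      intro ξ
      rw [List.map_cons, List.prod_cons, List.length_cons, pow_succ', mul_assoc]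
      change ‖ctr W n ((L.map (ctr W)).prod ξ)‖ ≤ _
      exact (ContinuousLinearMap.le_opNorm _ _).trans
        (mul_le_mul (h2 n) (ih ξ) (norm_nonneg _) zero_le_two)
  rw [wordState_apply]
  refine (norm_inner_le_norm _ _).trans ?_
  have := hL (List.ofFn j) (ket W 1)
  rw [List.map_ofFn, norm_ket, mul_one, List.length_ofFn] at this
  rw [norm_ket, one_mul]
  exact this

end StarCLT

/-! ### Values of the character at words in star-transpositions -/

namespace StarCLT

/-- The partial products of a word in star-transpositions. -/
def starWord (G : ℕ → ℕ) : ℕ → Equiv.Perm ℕ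
  | 0 => 1
  | l + 1 => starWord G l * Equiv.swap 0 (G l)

section Colouring

variable {α : Type*} {k : ℕ} {G T : ℕ → ℕ}

theorem starWord_succ_zero (l : ℕ) : starWord G (l + 1) 0 = starWord G l (G l) := by
  simp [starWord]

theorem starWord_succ_self (l : ℕ) : starWord G (l + 1) (G l) = starWord G l 0 := by
  simp [starWord]

theorem starWord_succ_of_ne {l n : ℕ} (h0 : n ≠ 0) (h : n ≠ G l) :
    starWord G (l + 1) n = starWord G l n := by
  simp [starWord, Equiv.swap_apply_of_ne_of_ne h0 h]

theorem starWord_of_ne {l n : ℕ} (h0 : n ≠ 0) (h : ∀ m < l, n ≠ G m) : starWord G l n = n := by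
  induction l with
  | zero => rfl
  | succ l ih =>
    rw [starWord_succ_of_ne h0 (h l (by omega)), ih fun m hm => h m (by omega)]

/-- A word in which every letter occurs at most twice, namely at the places `l` and `T l`. -/
structure IsPairedWord (k : ℕ) (G T : ℕ → ℕ) : Prop where
  lt : ∀ l < k, T l < k
  invol : ∀ l < k, T (T l) = l
  ne_zero : ∀ l < k, G l ≠ 0
  eq_iff : ∀ a < k, ∀ b < k, G a = G b ↔ a = b ∨ a = T b

/-- The colour of the point `G m` in the course of applying the word to a colouring `y`. -/
theorem IsPairedWord.colour (h : IsPairedWord k G T) (y : ℕ → α) {m : ℕ} (hm : m < k)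
    (hTm : T m ≤ m) {l : ℕ} (hl : l ≤ k) :
    y (starWord G l (G m)) = if l ≤ T m then y (G m) else
      if l ≤ m then y (starWord G (T m) 0) else y (starWord G m 0) := by
  induction l with
  | zero => simp [starWord]
  | succ l ih =>
    have ih := ih (by omega)
    have hG := h.eq_iff m hm l (by omega)
    have hinv := h.invol l (by omega)
    -- The colour at `G m` changes only when this letter is applied, and then becomes the colour at
    -- `0` just before.
    by_cases hml : G m = G l
    · rw [hml, starWord_succ_self]
      rcases hG.1 hml with rfl | rfl
      · rw [if_neg (by omega), if_neg (by omega)]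
      · rw [hinv] at hTm ⊢
        by_cases he : T l = l
        · rw [he]; simp
        · rw [if_neg (by omega), if_pos (by omega)]
    · rw [starWord_succ_of_ne (h.ne_zero m hm) hml, ih]
      have h1 : m ≠ l := fun e => hml (by rw [e])
      have h2 : T m ≠ l := fun e => hml (hG.2 (Or.inr (by rw [← e, h.invol m hm])))
      have e1 : l + 1 ≤ T m ↔ l ≤ T m := by omega
      have e2 : l + 1 ≤ m ↔ l ≤ m := by omega
      simp only [e1, e2]

/-- A fixed colouring of a paired word. -/
theorem IsPairedWord.of_fixed (h : IsPairedWord k G T) (y : ℕ → α)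
    (hy : ∀ n, y (starWord G k n) = y n) :
    (∀ l < k, y (starWord G (l + 1) 0) = y (starWord G (T l) 0)) ∧
      ∀ l < k, T l ≤ l → y (G l) = y (starWord G l 0) := by
  -- After its last occurrence, the letter keeps the colour it took from `0`; by invariance this is
  -- its original colour.
  have h2 : ∀ l < k, T l ≤ l → y (G l) = y (starWord G l 0) := by
    intro l hl hT
    rw [← hy (G l), h.colour y hl hT le_rfl, if_neg (by omega), if_neg (by omega)]
  refine ⟨fun l hl => ?_, h2⟩
  rw [starWord_succ_zero]
  rcases le_or_gt (T l) l with hT | hT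
  · rw [h.colour y hl hT hl.le]
    rcases hT.eq_or_lt with hT | hT
    · rw [if_pos hT.ge, h2 l hl hT.le, hT]
    · rw [if_neg (by omega), if_pos le_rfl]
  · have hGT : G l = G (T l) := (h.eq_iff l hl _ (h.lt l hl)).2 (Or.inr (h.invol l hl).symm)
    have hTT : T (T l) ≤ T l := by rw [h.invol l hl]; omega
    rw [hGT, h.colour y (h.lt l hl) hTT hl.le, if_pos (h.invol l hl).ge,
      h2 _ (h.lt l hl) hTT]

/-- Strong induction along the word: at a second occurrence the point `0` receives the colour stored
at the earlier time `T l`; at a first or only occurrence it receives the original colour of `G l`,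
which `hG` prescribes. -/
theorem IsPairedWord.path_eq (h : IsPairedWord k G T) (y : ℕ → α) (i : ℕ → α)
    (hi : ∀ l < k, i (l + 1) = i (T l)) (h0 : y 0 = i 0)
    (hG : ∀ l < k, T l ≤ l → y (G l) = i l) {l : ℕ} (hl : l ≤ k) : y (starWord G l 0) = i l := by
  induction l using Nat.strong_induction_on with
  | _ l ih =>
  rcases l with _ | l
  · exact h0
  have hl' : l < k := by omega
  rw [starWord_succ_zero, hi l hl']
  rcases le_or_gt (T l) l with hT | hT
  · rw [h.colour y hl' hT hl'.le]
    rcases hT.eq_or_lt with hT | hT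
    · rw [if_pos hT.ge, hG l hl' hT.le, hT]
    · rw [if_neg (by omega), if_pos le_rfl, ih _ (by omega) (by omega)]
  · have hGT : G l = G (T l) := (h.eq_iff l hl' _ (h.lt l hl')).2 (Or.inr (h.invol l hl').symm)
    have hTT : T (T l) ≤ T l := by rw [h.invol l hl']; omega
    rw [hGT, h.colour y (h.lt l hl') hTT hl'.le, if_pos (h.invol l hl').ge,
      hG _ (h.lt l hl') hTT]

/-- Converse of `of_fixed`: closedness of the path gives invariance at `0`, the prescribed colours
give it at the letters, and no other point moves. -/
theorem IsPairedWord.fixed (h : IsPairedWord k G T) (y : ℕ → α) (i : ℕ → α) (hk : i k = i 0)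
    (hi : ∀ l < k, i (l + 1) = i (T l)) (h0 : y 0 = i 0)
    (hG : ∀ l < k, T l ≤ l → y (G l) = i l) (n : ℕ) : y (starWord G k n) = y n := by
  by_cases hn0 : n = 0
  · rw [hn0, h.path_eq y i hi h0 hG le_rfl, hk, h0]
  by_cases hn : ∃ m < k, n = G m
  · have hlast : ∃ m < k, T m ≤ m ∧ n = G m := by
      obtain ⟨m, hm, rfl⟩ := hn
      rcases le_total (T m) m with hT | hT
      · exact ⟨m, hm, hT, rfl⟩
      · exact ⟨T m, h.lt m hm, by rwa [h.invol m hm],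
          (h.eq_iff m hm _ (h.lt m hm)).2 (Or.inr (h.invol m hm).symm)⟩
    obtain ⟨m, hm, hT, rfl⟩ := hlast
    rw [h.colour y hm hT le_rfl, if_neg (by omega), if_neg (by omega),
      h.path_eq y i hi h0 hG hm.le, hG m hm hT]
  · rw [starWord_of_ne hn0 fun m hm he => hn ⟨m, hm, he⟩]

end Colouring

variable {d : ℕ} (W : Weights d)

/-- Extension of a colouring of finitely many points by a constant. -/
def extendConst {N : ℕ} (a : Fin d) (x : Fin N → Fin d) (n : ℕ) : Fin d :=
  if h : n < N then x ⟨n, h⟩ else a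

/-- The default colour `a` is harmless because `σ` preserves the points below `N` and fixes all
others. -/
theorem extend_comp_iff_extendConst {N : ℕ} (a : Fin d) (x : Fin N → Fin d) (σ : Equiv.Perm ℕ)
    (hN : ∀ n, N ≤ n → σ n = n) :
    extend x ∘ σ = extend x ↔ ∀ n, extendConst a x (σ n) = extendConst a x n := by
  have hlt : ∀ n, n < N → σ n < N := fun n hn => by
    by_contra hc
    have := σ.injective (hN _ (not_lt.1 hc))
    omega
  rw [funext_iff]
  refine forall_congr' fun n => ?_
  by_cases hn : n < N
  · simp [extend, extendConst, hn, hlt n hn]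
  · simp [hN n (not_lt.1 hn)]

/-- The condition `t l ≤ l` selects the last occurrence of a letter, which is unique. So the colour
of `n` is either prescribed once or entirely free, and free colours contribute total weight `1`. -/
theorem sum_weight_filter {k N : ℕ} {g : Fin k → ℕ} {t : Fin k → Fin k} (hg0 : ∀ l, g l ≠ 0)
    (hg : ∀ a b, g a = g b ↔ a = b ∨ a = t b) (i : Fin k → Fin d) (i₀ : Fin d) (n : Fin N) :
    ∑ a with ((n : ℕ) = 0 → a = i₀) ∧ ∀ l, t l ≤ l → g l = n → a = i l, W.w a =
      (if (n : ℕ) = 0 then W.w i₀ else 1) *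
        ∏ l with t l ≤ l, if g l = n then W.w (i l) else 1 := by
  by_cases hn : (n : ℕ) = 0
  · have h1 : ∀ l, g l ≠ n := fun l => hn ▸ hg0 l
    simp [hn, hg0, Finset.filter_eq']
  · by_cases hl : ∃ l, t l ≤ l ∧ g l = n
    · obtain ⟨l, hlt, hln⟩ := hl
      have huniq : ∀ l', t l' ≤ l' → g l' = n → l' = l := by
        intro l' hl' hn'
        rcases (hg l' l).1 (hn'.trans hln.symm) with h | h
        · exact h
        rcases (hg l l').1 (hln.trans hn'.symm) with h' | h'
        · exact h'.symm
        · exact le_antisymm (h ▸ hlt) (h' ▸ hl')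
      have e1 : (Finset.univ.filter fun a => ((n : ℕ) = 0 → a = i₀) ∧
          ∀ l, t l ≤ l → g l = n → a = i l) = {i l} := by
        ext a
        simp only [Finset.mem_filter, Finset.mem_univ, true_and, Finset.mem_singleton, hn,
          false_imp_iff]
        exact ⟨fun h => h l hlt hln, fun h l' h1 h2 => by rw [huniq l' h1 h2]; exact h⟩
      rw [e1, Finset.sum_singleton, if_neg hn, one_mul, Finset.prod_eq_single_of_mem l
        (by simpa using hlt), if_pos hln]
      intro l' hl' hne
      rw [if_neg fun h => hne (huniq l' (by simpa using hl') h)]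
    · have e1 : (Finset.univ.filter fun a => ((n : ℕ) = 0 → a = i₀) ∧
          ∀ l, t l ≤ l → g l = n → a = i l) = Finset.univ := by
        ext a
        simp only [Finset.mem_filter, Finset.mem_univ, true_and, iff_true, hn, false_imp_iff]
        exact fun l h1 h2 => absurd ⟨l, h1, h2⟩ hl
      rw [e1, W.sum_eq_one, if_neg hn, one_mul, Finset.prod_eq_one]
      intro l hl'
      rw [if_neg fun h => hl ⟨l, by simpa using hl', h⟩]

theorem starWord_eq_prod {k : ℕ} (g : Fin k → ℕ) (G : ℕ → ℕ) (hG : ∀ l : Fin k, G l = g l) :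
    (((List.ofFn fun l => gam (g l)).prod : FinPerm) : Equiv.Perm ℕ) = starWord G k := by
  induction k with
  | zero => simp [starWord]
  | succ k ih =>
    have ih := ih (fun l => g l.castSucc) fun l => hG l.castSucc
    rw [List.ofFn_succ', List.concat_eq_append, List.prod_append, Subgroup.coe_mul, ih]
    have := hG (Fin.last k)
    simp only [Fin.val_last] at this
    simp [starWord, gam, this]

/-- The value of the character at a word in which every letter occurs once or twice. -/
theorem chi_star_word {k : ℕ} (hk : 1 ≤ k) {g : Fin k → ℕ} {t : Fin k → Fin k}
    (ht : Function.Involutive t) (hg0 : ∀ l, g l ≠ 0)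
    (hg : ∀ a b, g a = g b ↔ a = b ∨ a = t b) :
    chi W (List.ofFn fun l => gam (g l)).prod =
      ∑ i : Fin k → Fin d with i ∘ finRotate k = i ∘ t,
        W.w (i ⟨0, hk⟩) * ∏ l with t l ≤ l, W.w (i l) := by
  classical
  set G : ℕ → ℕ := fun l => if h : l < k then g ⟨l, h⟩ else 0 with hGdef
  set T : ℕ → ℕ := fun l => if h : l < k then t ⟨l, h⟩ else l with hTdef
  have hG : ∀ l : Fin k, G l = g l := fun l => by simp [hGdef]
  have hT : ∀ l : Fin k, T l = t l := fun l => by simp [hTdef]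
  have hw : IsPairedWord k G T := by
    refine ⟨fun l hl => ?_, fun l hl => ?_, fun l hl => ?_, fun a ha b hb => ?_⟩
    · rw [hT ⟨l, hl⟩]; exact (t _).2
    · rw [hT ⟨l, hl⟩, hT, ht]
    · rw [hG ⟨l, hl⟩]; exact hg0 _
    · rw [hG ⟨a, ha⟩, hG ⟨b, hb⟩, hg, hT ⟨b, hb⟩, Fin.ext_iff, Fin.ext_iff]
  have hσ := starWord_eq_prod g G hG
  obtain ⟨N, hN0, hgN⟩ : ∃ N, 0 < N ∧ ∀ l, g l < N :=
    ⟨Finset.univ.sup g + 1, by omega, fun l =>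
      Nat.lt_succ_of_le (Finset.le_sup (f := g) (Finset.mem_univ l))⟩
  have hNfix : ∀ n, N ≤ n →
      (((List.ofFn fun l => gam (g l)).prod : FinPerm) : Equiv.Perm ℕ) n = n := by
    intro n hn
    rw [hσ, starWord_of_ne (by omega)]
    intro m hm
    have := hgN ⟨m, hm⟩
    rw [hG ⟨m, hm⟩]
    omega
  rw [chi_eq_sum W _ N hNfix, ← Finset.sum_filter]
  have hd : Nonempty (Fin d) := by
    by_contra hc
    have := not_nonempty_iff.1 hc
    have := W.sum_eq_one
    simp at this
  obtain ⟨a₀⟩ := hd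
  set z : Fin k := ⟨0, hk⟩ with hz
  -- Times are read modulo `k`, so that the condition at the last place closes the path.
  have hrot : ∀ (i : Fin k → Fin d), i ∘ finRotate k = i ∘ t ↔
      ∀ l : ℕ, l < k → (fun l => i ⟨l % k, Nat.mod_lt _ hk⟩) (l + 1) =
        (fun l => i ⟨l % k, Nat.mod_lt _ hk⟩) (T l) := by
    intro i
    obtain ⟨k, rfl⟩ : ∃ k', k = k' + 1 := ⟨k - 1, by omega⟩
    have e1 : ∀ l : Fin (k + 1), finRotate (k + 1) l = ⟨(l + 1) % (k + 1), Nat.mod_lt _ hk⟩ := by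
      intro l
      rw [finRotate_apply]
      exact Fin.ext (by simp [Fin.val_add])
    have e2 : ∀ l : Fin (k + 1), t l = ⟨T l % (k + 1), Nat.mod_lt _ hk⟩ := by
      intro l
      exact Fin.ext (by simp only [hT]; rw [Nat.mod_eq_of_lt (t l).2])
    constructor
    · intro h l hl
      have := congrFun h ⟨l, hl⟩
      simp only [Function.comp_apply, e1, e2] at this
      exact this
    · intro h
      funext l
      simp only [Function.comp_apply, e1, e2]
      exact h l l.2
  have hcond : ∀ x : Fin N → Fin d, extend x ∘
      (((List.ofFn fun l => gam (g l)).prod : FinPerm) : Equiv.Perm ℕ) = extend x ↔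
      ∀ n, extendConst a₀ x (starWord G k n) = extendConst a₀ x n := by
    intro x
    rw [extend_comp_iff_extendConst a₀ x _ hNfix, hσ]
  -- The colour of the image of `0` under the successive partial products; invariant colourings are
  -- sorted by this path.
  let path : (Fin N → Fin d) → Fin k → Fin d := fun x l => extendConst a₀ x (starWord G l 0)
  have hx : ∀ (x : Fin N → Fin d) (n : Fin N), extendConst a₀ x n = x n := fun x n => by
    simp [extendConst]
  rw [← Finset.sum_fiberwise_of_maps_to (t := Finset.univ.filter
    fun i : Fin k → Fin d => i ∘ finRotate k = i ∘ t) (g := path)]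
  · refine Finset.sum_congr rfl fun i hi => ?_
    have hi := (hrot i).1 (Finset.mem_filter.1 hi).2
    -- The invariant colourings with a given path form a product set: `0` and the letters have
    -- prescribed colours, all other points are free. Hence their total weight factorises.
    have hset : (Finset.univ.filter fun x : Fin N → Fin d => extend x ∘
        (((List.ofFn fun l => gam (g l)).prod : FinPerm) : Equiv.Perm ℕ) = extend x).filter
          (fun x => path x = i) =
        Fintype.piFinset fun n : Fin N => Finset.univ.filter fun a =>
          ((n : ℕ) = 0 → a = i z) ∧ ∀ l, t l ≤ l → g l = n → a = i l := by
      ext x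
      simp only [Finset.mem_filter, Finset.mem_univ, true_and, Fintype.mem_piFinset, hcond]
      constructor
      · rintro ⟨hf, rfl⟩ n
        have := hw.of_fixed _ hf
        constructor
        · intro hn
          simp only [path, hz, starWord, Equiv.Perm.one_apply]
          rw [← hn, hx]
        · intro l hl hn
          have := this.2 l l.2 (by rw [hT]; exact hl)
          rw [hG, hn, hx] at this
          exact this
      · intro h
        have h0 : extendConst a₀ x 0 = i ⟨0 % k, Nat.mod_lt _ hk⟩ := by
          have := (h ⟨0, hN0⟩).1 rfl
          rw [← hx x ⟨0, hN0⟩] at this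
          simpa [hz] using this
        have hGl : ∀ l < k, T l ≤ l →
            extendConst a₀ x (G l) = i ⟨l % k, Nat.mod_lt _ hk⟩ := by
          intro l hl hTl
          have := (h ⟨g ⟨l, hl⟩, hgN _⟩).2 ⟨l, hl⟩ (by rw [hT ⟨l, hl⟩] at hTl; exact hTl) rfl
          rw [← hx x ⟨g ⟨l, hl⟩, hgN _⟩] at this
          rw [hG ⟨l, hl⟩, this]
          congr 1
          exact Fin.ext (Nat.mod_eq_of_lt hl).symm
        refine ⟨hw.fixed _ _ (by simp) hi h0 hGl, funext fun l => ?_⟩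
        simp only [path]
        rw [hw.path_eq _ _ hi h0 hGl l.2.le]
        congr 1
        exact Fin.ext (Nat.mod_eq_of_lt l.2)
    rw [hset, ← Finset.prod_univ_sum]
    simp_rw [sum_weight_filter W hg0 hg]
    rw [Finset.prod_mul_distrib, Finset.prod_comm]
    congr 1
    · rw [Finset.prod_eq_single ⟨0, hN0⟩] <;> simp +contextual [Fin.ext_iff]
    · refine Finset.prod_congr rfl fun l _ => ?_
      rw [Finset.prod_eq_single ⟨g l, hgN l⟩]
      · simp
      · intro n _ hn
        rw [if_neg fun h => hn (Fin.ext h.symm)]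
      · simp
  · intro x hx'
    simp only [Finset.mem_filter, Finset.mem_univ, true_and, hcond] at hx'
    simp only [Finset.mem_filter, Finset.mem_univ, true_and, hrot]
    have hpath : ∀ l ≤ k, path x ⟨l % k, Nat.mod_lt _ hk⟩ = extendConst a₀ x (starWord G l 0) := by
      intro l hl
      rcases hl.eq_or_lt with rfl | hl
      · simp only [path, Nat.mod_self, hx', starWord, Equiv.Perm.one_apply]
      · simp only [path, Nat.mod_eq_of_lt hl]
    intro l hl
    rw [hpath _ hl, hpath _ (hw.lt l hl).le]
    exact (hw.of_fixed _ hx').1 l hl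

end StarCLT

/-! ### Bicoloured pair-partitions and the expansion of paired words -/

namespace StarCLT

namespace BicolouredPairPartition

variable {k : ℕ} (ρ : BicolouredPairPartition k)

theorem mem_part_self (l : Fin k) : l ∈ ρ.toFinpartition.part l :=
  ρ.toFinpartition.mem_part (Finset.mem_univ l)

theorem part_mem_parts (l : Fin k) : ρ.toFinpartition.part l ∈ ρ.toFinpartition.parts :=
  ρ.toFinpartition.part_mem.2 (Finset.mem_univ l)

/-- The transposition of `x` splits off the product, and the remaining factors stabilise both its
points because distinct pairs are disjoint. -/
theorem sigmaBlue_of_mem_bluePairs {x : Fin k × Fin k} (hx : x ∈ ρ.bluePairs) :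
    ρ.sigmaBlue x.1 = x.2 ∧ ρ.sigmaBlue x.2 = x.1 := by
  have hfix : ∀ y : Fin k, (y = x.1 ∨ y = x.2) →
      ((ρ.bluePairs.erase x).noncommProd (fun x => Equiv.swap x.1 x.2)
        (ρ.pairwise_commute.mono (Finset.erase_subset _ _))) y = y := by
    intro y hy
    refine Subgroup.noncommProd_mem (MulAction.stabilizer (Equiv.Perm (Fin k)) y) _ fun z hz => ?_
    obtain ⟨hzx, hz⟩ := Finset.mem_erase.1 hz
    rw [MulAction.mem_stabilizer_iff, Equiv.Perm.smul_def]
    simp only [bluePairs, Finset.mem_filter, Finset.mem_univ, true_and] at hx hz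
    have hyx : y ∈ ({x.1, x.2} : Finset (Fin k)) := by simpa using hy
    have key : y ∈ ({z.1, z.2} : Finset (Fin k)) → False := by
      intro hyz
      have he := ρ.toFinpartition.eq_of_mem_parts (ρ.blue_subset hz.2) (ρ.blue_subset hx.2) hyz hyx
      have h1 : z.1 ∈ ({x.1, x.2} : Finset (Fin k)) := he ▸ by simp
      have h2 : z.2 ∈ ({x.1, x.2} : Finset (Fin k)) := he ▸ by simp
      have a1 := hx.1
      have a2 := hz.1
      simp only [Finset.mem_insert, Finset.mem_singleton] at h1 h2
      refine hzx ?_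
      rcases h1 with h1 | h1 <;> rcases h2 with h2 | h2
      · rw [h1, h2] at a2; exact absurd a2 (lt_irrefl _)
      · exact Prod.ext h1 h2
      · rw [h1, h2] at a2; exact absurd a2 a1.asymm
      · rw [h1, h2] at a2; exact absurd a2 (lt_irrefl _)
    exact Equiv.swap_apply_of_ne_of_ne (fun h => key (by simp [h])) (fun h => key (by simp [h]))
  unfold sigmaBlue
  rw [← Finset.mul_noncommProd_erase _ hx _ ρ.pairwise_commute]
  constructor
  · rw [Equiv.Perm.mul_apply, hfix _ (Or.inl rfl), Equiv.swap_apply_left]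
  · rw [Equiv.Perm.mul_apply, hfix _ (Or.inr rfl), Equiv.swap_apply_right]

theorem sigmaBlue_of_not_mem {l : Fin k} (hl : ρ.toFinpartition.part l ∉ ρ.blue) :
    ρ.sigmaBlue l = l := by
  refine Subgroup.noncommProd_mem (MulAction.stabilizer (Equiv.Perm (Fin k)) l) _ fun z hz => ?_
  rw [MulAction.mem_stabilizer_iff, Equiv.Perm.smul_def]
  simp only [bluePairs, Finset.mem_filter, Finset.mem_univ, true_and] at hz
  have key : l ∈ ({z.1, z.2} : Finset (Fin k)) → False := fun h =>
    hl (ρ.toFinpartition.part_eq_of_mem (ρ.blue_subset hz.2) h ▸ hz.2)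
  exact Equiv.swap_apply_of_ne_of_ne (fun h => key (by simp [h])) (fun h => key (by simp [h]))

theorem sigmaBlue_of_mem {l : Fin k} (hl : ρ.toFinpartition.part l ∈ ρ.blue) :
    ρ.sigmaBlue l ≠ l ∧ ρ.toFinpartition.part l = {l, ρ.sigmaBlue l} := by
  obtain ⟨a, b, hab, he⟩ := Finset.card_eq_two.1 (ρ.card_eq_two _ (ρ.blue_subset hl))
  have hmem := ρ.mem_part_self l
  wlog hla : l = a generalizing a b
  · refine this b a hab.symm (he.trans (Finset.pair_comm a b)) ?_
    rw [he] at hmem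
    simpa [hla] using hmem
  subst hla
  have hs : ρ.sigmaBlue l = b := by
    rcases hab.lt_or_gt with h | h
    · exact (ρ.sigmaBlue_of_mem_bluePairs (x := (l, b))
        (by simp only [bluePairs, Finset.mem_filter, Finset.mem_univ, true_and]
            exact ⟨h, he ▸ hl⟩)).1
    · exact (ρ.sigmaBlue_of_mem_bluePairs (x := (b, l))
        (by simp only [bluePairs, Finset.mem_filter, Finset.mem_univ, true_and]
            exact ⟨h, by rw [Finset.pair_comm, ← he]; exact hl⟩)).2
  rw [hs]
  exact ⟨hab.symm, he⟩

theorem part_sigmaBlue (l : Fin k) :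
    ρ.toFinpartition.part (ρ.sigmaBlue l) = ρ.toFinpartition.part l := by
  by_cases hl : ρ.toFinpartition.part l ∈ ρ.blue
  · refine ρ.toFinpartition.part_eq_of_mem (ρ.part_mem_parts l) ?_
    rw [(ρ.sigmaBlue_of_mem hl).2]
    simp
  · rw [ρ.sigmaBlue_of_not_mem hl]

theorem sigmaBlue_involutive : Function.Involutive ρ.sigmaBlue := by
  intro l
  by_cases hl : ρ.toFinpartition.part l ∈ ρ.blue
  · have hl' : ρ.toFinpartition.part (ρ.sigmaBlue l) ∈ ρ.blue := by rwa [part_sigmaBlue]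
    obtain ⟨h1, h2⟩ := ρ.sigmaBlue_of_mem hl
    obtain ⟨h3, h4⟩ := ρ.sigmaBlue_of_mem hl'
    have : ρ.sigmaBlue (ρ.sigmaBlue l) ∈ ({l, ρ.sigmaBlue l} : Finset (Fin k)) := by
      rw [← h2, ← part_sigmaBlue, h4]; simp
    simpa [h3] using this
  · rw [ρ.sigmaBlue_of_not_mem hl, ρ.sigmaBlue_of_not_mem hl]

theorem prod_bluePairs {M : Type*} [CommMonoid M] (f : Fin k → M) :
    ∏ x ∈ ρ.bluePairs, f x.2 = ∏ l with ρ.sigmaBlue l < l, f l := by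
  refine Finset.prod_bij' (fun x _ => x.2) (fun l _ => (ρ.sigmaBlue l, l)) ?_ ?_ ?_ ?_ ?_
  · intro x hx
    have h := (ρ.sigmaBlue_of_mem_bluePairs hx).2
    simp only [bluePairs, Finset.mem_filter, Finset.mem_univ, true_and] at hx ⊢
    rw [h]
    exact hx.1
  · intro l hl
    simp only [bluePairs, Finset.mem_filter, Finset.mem_univ, true_and] at hl ⊢
    refine ⟨hl, ?_⟩
    have hb : ρ.toFinpartition.part l ∈ ρ.blue := by
      by_contra hc
      rw [ρ.sigmaBlue_of_not_mem hc] at hl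
      exact lt_irrefl _ hl
    rw [Finset.pair_comm, ← (ρ.sigmaBlue_of_mem hb).2]
    exact hb
  · intro x hx
    exact Prod.ext (ρ.sigmaBlue_of_mem_bluePairs hx).2 rfl
  · intro l _; rfl
  · intro x _; rfl

theorem prod_redPairs {M : Type*} [CommMonoid M] (h : Finset (Fin k) → M) :
    ∏ x ∈ ρ.redPairs, h {x.1, x.2} = ∏ V ∈ ρ.red, h V := by
  refine Finset.prod_bij (fun x _ => {x.1, x.2}) ?_ ?_ ?_ ?_
  · intro x hx
    simp only [redPairs, Finset.mem_filter, Finset.mem_univ, true_and] at hx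
    exact hx.2
  · intro x hx z hz he
    simp only [redPairs, Finset.mem_filter, Finset.mem_univ, true_and] at hx hz
    have a1 := hx.1
    have a2 := hz.1
    have h1 : x.1 ∈ ({z.1, z.2} : Finset (Fin k)) := he ▸ by simp
    have h2 : x.2 ∈ ({z.1, z.2} : Finset (Fin k)) := he ▸ by simp
    simp only [Finset.mem_insert, Finset.mem_singleton] at h1 h2
    rcases h1 with h1 | h1 <;> rcases h2 with h2 | h2
    · rw [h1, h2] at a1; exact absurd a1 (lt_irrefl _)
    · exact Prod.ext h1 h2
    · rw [h1, h2] at a1; exact absurd a1 a2.asymm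
    · rw [h1, h2] at a1; exact absurd a1 (lt_irrefl _)
  · intro V hV
    obtain ⟨a, b, hab, rfl⟩ := Finset.card_eq_two.1
      (ρ.card_eq_two V (Finset.sdiff_subset hV))
    rcases hab.lt_or_gt with h | h
    · exact ⟨(a, b), by simpa [redPairs, h] using hV, rfl⟩
    · exact ⟨(b, a), by simpa [redPairs, h, Finset.pair_comm] using hV, Finset.pair_comm _ _⟩
  · intro x _; rfl

theorem prod_fixed {M : Type*} [CommMonoid M] (f : Fin k → M) :
    ∏ l with ρ.sigmaBlue l = l, f l = ∏ V ∈ ρ.red, ∏ l ∈ V, f l := by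
  rw [← Finset.prod_biUnion]
  · refine Finset.prod_congr ?_ fun _ _ => rfl
    ext l
    simp only [Finset.mem_filter, Finset.mem_univ, true_and, Finset.mem_biUnion]
    constructor
    · intro hl
      refine ⟨ρ.toFinpartition.part l, Finset.mem_sdiff.2 ⟨ρ.part_mem_parts l, fun hb => ?_⟩,
        ρ.mem_part_self l⟩
      exact (ρ.sigmaBlue_of_mem hb).1 hl
    · rintro ⟨V, hV, hl⟩
      obtain ⟨hV1, hV2⟩ := Finset.mem_sdiff.1 hV
      refine ρ.sigmaBlue_of_not_mem ?_
      rwa [ρ.toFinpartition.part_eq_of_mem hV1 hl]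
  · exact ρ.toFinpartition.disjoint.subset (Finset.coe_subset.2 Finset.sdiff_subset)

/-- The larger points of the blue pairs together with all red points are exactly the `l` with
`σ_blue l ≤ l`. This matches the product over last occurrences in `chi_star_word`, up to one sign
per red pair. -/
theorem prod_pairs (f : Fin k → ℝ) :
    (∏ x ∈ ρ.bluePairs, f x.2) * ∏ x ∈ ρ.redPairs, -(f x.1 * f x.2) =
      (-1) ^ ρ.red.card * ∏ l with ρ.sigmaBlue l ≤ l, f l := by
  have h1 : ∏ x ∈ ρ.redPairs, -(f x.1 * f x.2) =
      ∏ V ∈ ρ.red, -∏ l ∈ V, f l := by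
    rw [← ρ.prod_redPairs fun V => -∏ l ∈ V, f l]
    refine Finset.prod_congr rfl fun x hx => ?_
    simp only [redPairs, Finset.mem_filter, Finset.mem_univ, true_and] at hx
    rw [Finset.prod_pair hx.1.ne]
  have h2 : (Finset.univ.filter fun l => ρ.sigmaBlue l ≤ l) =
      (Finset.univ.filter fun l => ρ.sigmaBlue l < l) ∪
        Finset.univ.filter fun l => ρ.sigmaBlue l = l := by
    ext l
    simp [le_iff_lt_or_eq]
  rw [h1, ρ.prod_bluePairs, h2, Finset.prod_union, ρ.prod_fixed,
    Finset.prod_neg]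
  · ring
  · rw [Finset.disjoint_filter]
    exact fun l _ h1 h2 => h1.ne h2

end BicolouredPairPartition

variable {d : ℕ} {W : Weights d} {k : ℕ}

/-- Expansion of a pair of centred letters. -/
theorem wordState_update_ctr_pair {Z : Fin k → GNS W →L[ℂ] GNS W} {p q : Fin k} (hpq : p ≠ q)
    {F : Set ℕ} (hF : F.Finite) (h0 : 0 ∈ F) {v : ℕ} (hv : v ∉ F)
    (hZ : ∀ l, l ≠ p → l ≠ q → Z l ∈ invariants W F) :
    wordState W k (Function.update (Function.update Z p (ctr W v)) q (ctr W v)) =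
      wordState W k (Function.update (Function.update Z p (U W (gam v))) q (U W (gam v))) -
        wordState W k (Function.update (Function.update Z p (A₀ W)) q (A₀ W)) := by
  have h1 : wordState W k (Function.update (Function.update Z p (A₀ W)) q (U W (gam v))) =
      wordState W k (Function.update (Function.update Z p (A₀ W)) q (A₀ W)) := by
    refine wordState_update_U_gam hF h0 hv fun l hl => ?_
    by_cases h : l = p
    · subst h; simpa using A₀_mem_invariants h0
    · simpa [h] using hZ l h hl
  have h2 : wordState W k (Function.update (Function.update Z q (A₀ W)) p (U W (gam v))) =
      wordState W k (Function.update (Function.update Z q (A₀ W)) p (A₀ W)) := by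
    refine wordState_update_U_gam hF h0 hv fun l hl => ?_
    by_cases h : l = q
    · subst h; simpa using A₀_mem_invariants h0
    · simpa [h] using hZ l hl h
  have hc : ∀ A B, Function.update (Function.update Z p A) q B =
      Function.update (Function.update Z q B) p A := fun A B => Function.update_comm hpq A B Z
  -- Of the four terms, the two with a single `U` equal the one with two `A₀`, whose total
  -- coefficient becomes `1 - 1 - 1 = -1`.
  rw [ctr, MultilinearMap.map_update_sub, hc _ (U W (gam v)), hc _ (A₀ W),
    MultilinearMap.map_update_sub, MultilinearMap.map_update_sub, h2, ← hc, ← hc (A₀ W), h1]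
  ring

/-- The word in which the letters of the blocks in `B` are `U(γ)`, those of the other blocks in `P`
are `A_0`, and all others are centred. -/
def mixedWord (W : Weights d) (π : Finpartition (Finset.univ : Finset (Fin k))) (j : Fin k → ℕ)
    (P B : Finset (Finset (Fin k))) (l : Fin k) : GNS W →L[ℂ] GNS W :=
  if π.part l ∈ B then U W (gam (j l)) else if π.part l ∈ P then A₀ W else ctr W (j l)

theorem mixedWord_mem_invariants {π : Finpartition (Finset.univ : Finset (Fin k))} {j : Fin k → ℕ}
    {P B : Finset (Finset (Fin k))} {F : Set ℕ} (h0 : 0 ∈ F) {l : Fin k} (hl : j l ∈ F) :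
    mixedWord W π j P B l ∈ invariants W F := by
  unfold mixedWord
  split_ifs
  · exact U_gam_mem_invariants h0 hl
  · exact A₀_mem_invariants h0
  · exact ctr_mem_invariants h0 hl

/-- Induction on the set `P` of expanded pairs. Each new pair either joins `B`, keeping its letters
`U`, or becomes a pair of `A₀` at the cost of a sign. -/
theorem wordState_ctr_eq_sum_mixedWord {π : Finpartition (Finset.univ : Finset (Fin k))}
    (hπ : ∀ V ∈ π.parts, V.card = 2) {j : Fin k → ℕ} (hj0 : ∀ l, j l ≠ 0)
    (hj : ∀ a b, j a = j b ↔ π.part a = π.part b) (P : Finset (Finset (Fin k)))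
    (hP : P ⊆ π.parts) :
    wordState W k (fun l => ctr W (j l)) =
      ∑ B ∈ P.powerset, (-1) ^ (P \ B).card * wordState W k (mixedWord W π j P B) := by
  induction P using Finset.induction_on with
  | empty =>
    simp only [Finset.powerset_empty, Finset.sum_singleton, Finset.sdiff_empty, Finset.card_empty,
      pow_zero, one_mul]
    congr 1
  | insert V P hV ih =>
    rw [ih fun X hX => hP (Finset.mem_insert_of_mem hX), Finset.sum_powerset_insert hV,
      ← Finset.sum_add_distrib]
    refine Finset.sum_congr rfl fun B hB => ?_
    have hBP := Finset.mem_powerset.1 hB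
    have hVB : V ∉ B := fun h => hV (hBP h)
    rw [Finset.insert_sdiff_of_notMem _ hVB, Finset.card_insert_of_notMem (by simp [hV]),
      Finset.insert_sdiff_insert, Finset.sdiff_insert_of_notMem hV]
    have hVπ := hP (Finset.mem_insert_self V P)
    obtain ⟨p, q, hpq, hVpq⟩ := Finset.card_eq_two.1 (hπ V hVπ)
    have hpV : π.part p = V := π.part_eq_of_mem hVπ (by simp [hVpq])
    have hqV : π.part q = V := π.part_eq_of_mem hVπ (by simp [hVpq])
    have hne : ∀ l, l ≠ p → l ≠ q → π.part l ≠ V := fun l h1 h2 h => by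
      have : l ∈ V := h ▸ π.mem_part (Finset.mem_univ l)
      rw [hVpq] at this
      simp [h1, h2] at this
    have hjpq : j q = j p := (hj q p).2 (hqV.trans hpV.symm)
    have key : ∀ (A : GNS W →L[ℂ] GNS W) (P' B' : Finset (Finset (Fin k))),
        mixedWord W π j P' B' p = A → mixedWord W π j P' B' q = A →
        (∀ l, l ≠ p → l ≠ q → mixedWord W π j P' B' l = mixedWord W π j P B l) →
        mixedWord W π j P' B' =
          Function.update (Function.update (mixedWord W π j P B) p A) q A := by
      intro A P' B' hp hq hl
      funext l
      by_cases h2 : l = q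
      · subst h2; simpa using hq
      by_cases h1 : l = p
      · subst h1; simpa [hpq] using hp
      · simpa [h1, h2] using hl l h1 h2
    have e1 := key (ctr W (j p)) P B (by simp [mixedWord, hpV, hV, hVB])
      (by simp [mixedWord, hqV, hV, hVB, hjpq]) fun _ _ _ => rfl
    have e2 := key (A₀ W) (insert V P) B (by simp [mixedWord, hpV, hVB])
      (by simp [mixedWord, hqV, hVB]) fun l h1 h2 => by
        simp [mixedWord, hne l h1 h2]
    have e3 := key (U W (gam (j p))) (insert V P) (insert V B) (by simp [mixedWord, hpV])
      (by simp [mixedWord, hqV, hjpq]) fun l h1 h2 => by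
        simp [mixedWord, hne l h1 h2]
    have := wordState_update_ctr_pair (W := W) (Z := mixedWord W π j P B) hpq
      (F := insert 0 (j '' {l | l ≠ p ∧ l ≠ q})) (Set.toFinite _) (by simp) (v := j p) (by
        rintro (h | ⟨l, hl, h⟩)
        · exact hj0 p h
        · exact hne l hl.1 hl.2 (((hj l p).1 h).trans hpV))
      fun l h1 h2 => mixedWord_mem_invariants (by simp) (by right; exact ⟨l, ⟨h1, h2⟩, rfl⟩)
    rw [← e1, ← e2, ← e3] at this
    rw [this]
    ring

/-- Letters `A_0` may be replaced with letters `U(γ)` in new points. -/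
theorem wordState_ite_A₀ {g : Fin k → ℕ} (hg0 : ∀ l, g l ≠ 0) (S : Finset (Fin k))
    (hS : ∀ l ∈ S, ∀ l', g l' = g l → l' = l) :
    wordState W k (fun l => if l ∈ S then A₀ W else U W (gam (g l))) =
      wordState W k fun l => U W (gam (g l)) := by
  induction S using Finset.induction_on with
  | empty => simp
  | insert p S hp ih =>
    rw [← ih fun l hl => hS l (Finset.mem_insert_of_mem hl)]
    set Z : Fin k → GNS W →L[ℂ] GNS W := fun l => if l ∈ S then A₀ W else U W (gam (g l))
    have e1 : (fun l => if l ∈ insert p S then A₀ W else U W (gam (g l))) =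
        Function.update Z p (A₀ W) := by
      funext l
      by_cases h : l = p
      · subst h; simp
      · simp [h, Z]
    have e2 : Z = Function.update Z p (U W (gam (g p))) := by
      rw [show U W (gam (g p)) = Z p by simp [Z, hp], Function.update_eq_self]
    rw [e1]
    conv_rhs => rw [e2]
    refine (wordState_update_U_gam (F := insert 0 (g '' {l | l ≠ p})) (Set.toFinite _) (by simp)
      ?_ fun l hl => ?_).symm
    · rintro (h | ⟨l, hl, h⟩)
      · exact hg0 p h
      · exact hl (hS p (Finset.mem_insert_self _ _) l h)
    · simp only [Z]
      split_ifs
      · exact A₀_mem_invariants (by simp)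
      · exact U_gam_mem_invariants (by simp) (by right; exact ⟨l, hl, rfl⟩)

theorem wordState_U_gam (g : Fin k → ℕ) :
    wordState W k (fun l => U W (gam (g l))) = (chi W (List.ofFn fun l => gam (g l)).prod : ℂ) := by
  have : ∀ L : List ℕ, (L.map fun n => U W (gam n)).prod (ket W 1) =
      ket W (L.map gam).prod := by
    intro L
    induction L with
    | nil => rfl
    | cons n L ih =>
      rw [List.map_cons, List.prod_cons, List.map_cons, List.prod_cons, ← U_ket, ← ih]
      rfl
  have := this (List.ofFn g)
  rw [List.map_ofFn, List.map_ofFn] at this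
  rw [wordState_apply]
  change ⟪ket W 1, (List.ofFn ((fun n => U W (gam n)) ∘ g)).prod (ket W 1)⟫_ℂ = _
  rw [this, inner_ket, one_mul, chi_inv]
  rfl

/-- The contribution of a bicoloured pair-partition to the limit moments. -/
def BicolouredPairPartition.weight (W : Weights d) (hk : 1 ≤ k)
    (ρ : BicolouredPairPartition k) : ℝ :=
  ∑ i : Fin k → Fin d with i ∘ finRotate k = i ∘ ρ.sigmaBlue,
    W.w (i ⟨0, hk⟩) * ((∏ x ∈ ρ.bluePairs, W.w (i x.2)) *
      ∏ x ∈ ρ.redPairs, -(W.w (i x.1) * W.w (i x.2)))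

/-- With the red letters moved to distinct new points, equal letters sit exactly at places exchanged
by `σ_blue`, so `chi_star_word` applies with `t = σ_blue`. -/
theorem wordState_mixedWord (hk : 1 ≤ k) (ρ : BicolouredPairPartition k) {j : Fin k → ℕ}
    (hj0 : ∀ l, j l ≠ 0)
    (hj : ∀ a b, j a = j b ↔ ρ.toFinpartition.part a = ρ.toFinpartition.part b) :
    (-1) ^ ρ.red.card *
      wordState W k (mixedWord W ρ.toFinpartition j ρ.toFinpartition.parts ρ.blue) =
      (ρ.weight W hk : ℂ) := by
  classical
  obtain ⟨N, hN⟩ : ∃ N, ∀ l, j l < N :=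
    ⟨Finset.univ.sup j + 1, fun l =>
      Nat.lt_succ_of_le (Finset.le_sup (f := j) (Finset.mem_univ l))⟩
  -- `N` exceeds all letters of the word, so `N + l` is a fresh point for each red place.
  set g : Fin k → ℕ := fun l => if ρ.toFinpartition.part l ∈ ρ.blue then j l else N + l with hg
  have hg0 : ∀ l, g l ≠ 0 := by
    intro l
    have := hN l
    simp only [hg]
    split_ifs
    · exact hj0 l
    · omega
  have hS : ∀ l, ρ.toFinpartition.part l ∉ ρ.blue → ∀ l', g l' = g l → l' = l := by
    intro l hl l' h
    have := hN l'
    simp only [hg, if_neg hl] at h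
    split_ifs at h
    · omega
    · exact Fin.ext (by omega)
  have hgt : ∀ a b, g a = g b ↔ a = b ∨ a = ρ.sigmaBlue b := by
    intro a b
    constructor
    · intro h
      by_cases hb : ρ.toFinpartition.part b ∈ ρ.blue
      · by_cases ha : ρ.toFinpartition.part a ∈ ρ.blue
        · simp only [hg, if_pos ha, if_pos hb] at h
          have : a ∈ ρ.toFinpartition.part b := (hj a b).1 h ▸ ρ.mem_part_self a
          rw [(ρ.sigmaBlue_of_mem hb).2] at this
          simpa using this
        · exact Or.inl (hS a ha b h.symm).symm
      · exact Or.inl (hS b hb a h)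
    · rintro (rfl | rfl)
      · rfl
      · by_cases hb : ρ.toFinpartition.part b ∈ ρ.blue
        · simp only [hg, ρ.part_sigmaBlue, if_pos hb]
          rw [hj, ρ.part_sigmaBlue]
        · rw [ρ.sigmaBlue_of_not_mem hb]
  have e1 : mixedWord W ρ.toFinpartition j ρ.toFinpartition.parts ρ.blue = fun l =>
      if l ∈ Finset.univ.filter (fun l => ρ.toFinpartition.part l ∉ ρ.blue) then A₀ W
        else U W (gam (g l)) := by
    funext l
    by_cases hl : ρ.toFinpartition.part l ∈ ρ.blue
    · simp [mixedWord, hl, hg]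
    · simp [mixedWord, hl, ρ.part_mem_parts l]
  rw [e1, wordState_ite_A₀ hg0 _ (by simpa using hS), wordState_U_gam,
    chi_star_word W hk ρ.sigmaBlue_involutive hg0 hgt]
  have e2 : ρ.weight W hk = (-1) ^ ρ.red.card *
      ∑ i : Fin k → Fin d with i ∘ finRotate k = i ∘ ρ.sigmaBlue,
        W.w (i ⟨0, hk⟩) * ∏ l with ρ.sigmaBlue l ≤ l, W.w (i l) := by
    rw [BicolouredPairPartition.weight, Finset.mul_sum]
    refine Finset.sum_congr rfl fun i _ => ?_
    rw [ρ.prod_pairs fun l => W.w (i l)]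
    ring
  rw [e2]
  push_cast
  rfl

/-- The sets `B` of the full expansion are the possible sets of blue pairs; the result depends on
the word only through `π`. -/
theorem wordState_ctr_of_pairs (hk : 1 ≤ k) {π : Finpartition (Finset.univ : Finset (Fin k))}
    (hπ : ∀ V ∈ π.parts, V.card = 2) {j : Fin k → ℕ} (hj0 : ∀ l, j l ≠ 0)
    (hj : ∀ a b, j a = j b ↔ π.part a = π.part b) :
    wordState W k (fun l => ctr W (j l)) =
      ((∑ ρ : BicolouredPairPartition k with ρ.toFinpartition = π, ρ.weight W hk : ℝ) : ℂ) := by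
  rw [wordState_ctr_eq_sum_mixedWord hπ hj0 hj π.parts le_rfl]
  push_cast
  symm
  refine Finset.sum_bij' (fun ρ _ => ρ.blue)
    (fun B hB => ⟨π, hπ, B, Finset.mem_powerset.1 hB⟩) ?_ ?_ ?_ ?_ ?_
  · intro ρ hρ
    obtain rfl := (Finset.mem_filter.1 hρ).2
    exact Finset.mem_powerset.2 ρ.blue_subset
  · intro B hB; simp
  · intro ρ hρ
    obtain rfl := (Finset.mem_filter.1 hρ).2
    rfl
  · intro B hB; rfl
  · intro ρ hρ
    obtain rfl := (Finset.mem_filter.1 hρ).2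
    exact (wordState_mixedWord hk ρ hj0 hj).symm

end StarCLT

/-! ### Counting words and passing to the limit -/

namespace StarCLT

section Counting

variable {k : ℕ}

/-- The partition of the places of a word into the blocks of equal letters. -/
def kerPartition (j : Fin k → ℕ) : Finpartition (Finset.univ : Finset (Fin k)) :=
  letI : DecidableRel (Setoid.ker j) := fun a b => inferInstanceAs (Decidable (j a = j b))
  Finpartition.ofSetoid (Setoid.ker j)

theorem kerPartition_part_eq_iff (j : Fin k → ℕ) (a b : Fin k) :
    (kerPartition j).part a = (kerPartition j).part b ↔ j a = j b := by
  let : DecidableRel (Setoid.ker j) := fun a b => inferInstanceAs (Decidable (j a = j b))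
  rw [← (kerPartition j).mem_part_iff_part_eq_part (Finset.mem_univ a) (Finset.mem_univ b)]
  exact Finpartition.mem_part_ofSetoid_iff_rel.trans eq_comm

theorem finpartition_eq_of_part {π π' : Finpartition (Finset.univ : Finset (Fin k))}
    (h : ∀ a, π.part a = π'.part a) : π = π' := by
  have key : ∀ π : Finpartition (Finset.univ : Finset (Fin k)),
      π.parts = Finset.univ.image π.part := by
    intro π
    ext V
    simp only [Finset.mem_image, Finset.mem_univ, true_and]
    constructor
    · intro hV
      obtain ⟨a, ha⟩ := π.nonempty_of_mem_parts hV
      exact ⟨a, π.part_eq_of_mem hV ha⟩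
    · rintro ⟨a, rfl⟩
      exact π.part_mem.2 (Finset.mem_univ a)
  refine Finpartition.ext ?_
  rw [key π, key π', funext h]

theorem eq_kerPartition_iff (π : Finpartition (Finset.univ : Finset (Fin k))) (j : Fin k → ℕ) :
    kerPartition j = π ↔ ∀ a b, j a = j b ↔ π.part a = π.part b := by
  constructor
  · rintro rfl a b
    exact (kerPartition_part_eq_iff j a b).symm
  · intro h
    refine finpartition_eq_of_part fun a => ?_
    ext b
    rw [Finpartition.mem_part_iff_part_eq_part _ (Finset.mem_univ _) (Finset.mem_univ _),
      Finpartition.mem_part_iff_part_eq_part _ (Finset.mem_univ _) (Finset.mem_univ _),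
      kerPartition_part_eq_iff, h]

/-- The number of words in `n` letters with a given partition into blocks of equal letters. -/
theorem card_filter_kerPartition (n : ℕ) (π : Finpartition (Finset.univ : Finset (Fin k))) :
    ((Fintype.piFinset fun _ : Fin k => Finset.Icc 1 n).filter
      fun j => kerPartition j = π).card = n.descFactorial π.parts.card := by
  -- Such a word is an injective choice of a letter for every block.
  have h1 : n.descFactorial π.parts.card = Fintype.card (π.parts ↪ Finset.Icc 1 n) := by
    rw [Fintype.card_embedding_eq]; simp
  rw [h1, ← Finset.card_univ]
  have hpart : ∀ l, π.part l ∈ π.parts := fun l => π.part_mem.2 (Finset.mem_univ l)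
  have hne : ∀ V : π.parts, ∃ l, π.part l = V := fun V => by
    obtain ⟨l, hl⟩ := π.nonempty_of_mem_parts V.2
    exact ⟨l, π.part_eq_of_mem V.2 hl⟩
  symm
  refine Finset.card_bij (fun e _ l => (e ⟨π.part l, hpart l⟩ : ℕ)) ?_ ?_ ?_
  · intro e _
    simp only [Finset.mem_filter, Fintype.mem_piFinset, eq_kerPartition_iff]
    refine ⟨fun l => (e _).2, fun a b => ?_⟩
    rw [Subtype.coe_inj, e.injective.eq_iff, Subtype.mk.injEq]
  · intro e _ e' _ h
    ext V
    obtain ⟨l, hl⟩ := hne V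
    have := congrFun h l
    have hV : V = ⟨π.part l, hpart l⟩ := Subtype.ext hl.symm
    rw [hV]
    exact this
  · intro j hj
    simp only [Finset.mem_filter, Fintype.mem_piFinset, eq_kerPartition_iff] at hj
    choose r hr using hne
    refine ⟨⟨fun V => ⟨j (r V), hj.1 _⟩, fun V V' h => ?_⟩, Finset.mem_univ _, funext fun l => ?_⟩
    · rw [Subtype.mk.injEq, hj.2, hr, hr] at h
      exact Subtype.ext h
    · change j (r ⟨π.part l, hpart l⟩) = j l
      rw [hj.2, hr]

theorem tendsto_inv_sqrt_pow_mul_descFactorial {m : ℕ} (hm : k = 2 * m) :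
    Tendsto (fun n : ℕ => ((Real.sqrt n)⁻¹) ^ k * (n.descFactorial m : ℝ)) atTop (𝓝 1) := by
  have h := (isEquivalent_descFactorial m)
  rw [Asymptotics.isEquivalent_iff_tendsto_one] at h
  · refine h.congr fun n => ?_
    simp only [Pi.div_apply]
    rw [hm, pow_mul, inv_pow, Real.sq_sqrt (Nat.cast_nonneg n), inv_pow, div_eq_inv_mul]
  · filter_upwards [eventually_gt_atTop 0] with n hn
    have : (0 : ℝ) < n := by exact_mod_cast hn
    positivity

theorem tendsto_inv_sqrt_pow_mul_descFactorial_zero {m : ℕ} (hm : 2 * m < k) :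
    Tendsto (fun n : ℕ => ((Real.sqrt n)⁻¹) ^ k * (n.descFactorial m : ℝ)) atTop (𝓝 0) := by
  have h := tendsto_inv_sqrt_pow_mul_descFactorial (k := 2 * m) (m := m) rfl
  have h0 : Tendsto (fun n : ℕ => ((Real.sqrt n)⁻¹) ^ (k - 2 * m)) atTop (𝓝 0) := by
    have : Tendsto (fun n : ℕ => (Real.sqrt n)⁻¹) atTop (𝓝 0) :=
      tendsto_inv_atTop_zero.comp (Real.tendsto_sqrt_atTop.comp tendsto_natCast_atTop_atTop)
    simpa [show k - 2 * m ≠ 0 by omega] using this.pow (k - 2 * m)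
  have := h0.mul h
  rw [zero_mul] at this
  refine this.congr fun n => ?_
  rw [← mul_assoc, ← pow_add]
  congr 2
  omega

/-- A bicoloured pair-partition is determined by the set of its blue points and the involution
exchanging the two points of every pair. -/
theorem card_bicolouredPairPartition_le :
    Fintype.card (BicolouredPairPartition k) ≤ 2 ^ k * k.factorial := by
  -- Painting every pair blue makes `sigmaBlue` the involution of the whole pairing.
  let allBlue : BicolouredPairPartition k → BicolouredPairPartition k := fun ρ =>
    ⟨ρ.toFinpartition, ρ.card_eq_two, ρ.toFinpartition.parts, le_rfl⟩
  have hpart : ∀ ρ : BicolouredPairPartition k, ∀ l,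
      ρ.toFinpartition.part l = {l, (allBlue ρ).sigmaBlue l} := fun ρ l =>
    ((allBlue ρ).sigmaBlue_of_mem (ρ.part_mem_parts l)).2
  have hblue : ∀ ρ : BicolouredPairPartition k,
      ρ.blue = (Finset.univ.filter fun l => ρ.toFinpartition.part l ∈ ρ.blue).image
        ρ.toFinpartition.part := by
    intro ρ
    ext V
    simp only [Finset.mem_image, Finset.mem_filter, Finset.mem_univ, true_and]
    constructor
    · intro hV
      obtain ⟨a, ha⟩ := ρ.toFinpartition.nonempty_of_mem_parts (ρ.blue_subset hV)
      have := ρ.toFinpartition.part_eq_of_mem (ρ.blue_subset hV) ha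
      exact ⟨a, by rwa [this], this⟩
    · rintro ⟨a, ha, rfl⟩
      exact ha
  have hinj : Function.Injective fun ρ : BicolouredPairPartition k =>
      (Finset.univ.filter fun l => ρ.toFinpartition.part l ∈ ρ.blue, (allBlue ρ).sigmaBlue) := by
    intro ρ ρ' h
    simp only [Prod.mk.injEq] at h
    have hp : ρ.toFinpartition = ρ'.toFinpartition :=
      finpartition_eq_of_part fun a => by rw [hpart, hpart, h.2]
    have hb : ρ.blue = ρ'.blue := by
      rw [hblue ρ, hblue ρ', h.1, hp]
    cases ρ
    cases ρ'
    simp_all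
  refine (Fintype.card_le_of_injective _ hinj).trans ?_
  simp [Fintype.card_prod, Fintype.card_perm]

end Counting

variable {d : ℕ} (W : Weights d)

theorem Weights.le_one (i : Fin d) : W.w i ≤ 1 := by
  rw [← W.sum_eq_one]
  exact Finset.single_le_sum (fun j _ => (W.pos j).le) (Finset.mem_univ i)

/-- There are at most `d ^ k` summands, each a product of weights in `(0, 1]` up to sign. -/
theorem abs_weight_le {k : ℕ} (hk : 1 ≤ k) (ρ : BicolouredPairPartition k) :
    |ρ.weight W hk| ≤ (d : ℝ) ^ k := by
  have h1 : ∀ i : Fin k → Fin d, |W.w (i ⟨0, hk⟩) * ((∏ x ∈ ρ.bluePairs, W.w (i x.2)) *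
      ∏ x ∈ ρ.redPairs, -(W.w (i x.1) * W.w (i x.2)))| ≤ 1 := by
    intro i
    rw [ρ.prod_pairs fun l => W.w (i l), abs_mul, abs_mul, abs_pow, abs_neg, abs_one, one_pow,
      one_mul, abs_of_pos (W.pos _), abs_of_nonneg (Finset.prod_nonneg fun l _ => (W.pos _).le)]
    exact mul_le_one₀ (W.le_one _) (Finset.prod_nonneg fun l _ => (W.pos _).le)
      (Finset.prod_le_one (fun l _ => (W.pos _).le) fun l _ => W.le_one _)
  rw [BicolouredPairPartition.weight]
  refine (Finset.abs_sum_le_sum_abs _ _).trans ((Finset.sum_le_sum fun i _ => h1 i).trans ?_)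
  rw [Finset.sum_const, nsmul_eq_mul, mul_one]
  calc ((Finset.univ.filter fun i : Fin k → Fin d =>
        i ∘ finRotate k = i ∘ ρ.sigmaBlue).card : ℝ)
      ≤ (Fintype.card (Fin k → Fin d) : ℝ) := by exact_mod_cast Finset.card_le_univ _
    _ = (d : ℝ) ^ k := by simp

/-- The moments of the limit law. -/
def limitMoment (k : ℕ) : ℝ :=
  if hk : 1 ≤ k then ∑ ρ : BicolouredPairPartition k, ρ.weight W hk else 1

theorem limitMoment_le (k : ℕ) : limitMoment W k ≤ (2 * d : ℝ) ^ k * k.factorial := by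
  unfold limitMoment
  split_ifs with hk
  · calc ∑ ρ : BicolouredPairPartition k, ρ.weight W hk
        ≤ ∑ _ρ : BicolouredPairPartition k, (d : ℝ) ^ k :=
          Finset.sum_le_sum fun ρ _ => (le_abs_self _).trans (abs_weight_le W hk ρ)
      _ = Fintype.card (BicolouredPairPartition k) * (d : ℝ) ^ k := by simp
      _ ≤ (2 ^ k * k.factorial : ℕ) * (d : ℝ) ^ k := by
          gcongr
          exact card_bicolouredPairPartition_le
      _ = (2 * d : ℝ) ^ k * k.factorial := by push_cast; ring
  · obtain rfl : k = 0 := by omega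
    simp

theorem moment_cltLaw (n k : ℕ) :
    ∫ t : ℝ, t ^ k ∂(cltLaw W n : Measure ℝ) = ((Real.sqrt n)⁻¹) ^ k *
      ∑ j ∈ Fintype.piFinset fun _ : Fin k => Finset.Icc 1 n,
        (wordState W k fun l => ctr W (j l)).re := by
  have h1 : (wordState W k fun _ => ∑ i ∈ Finset.Icc 1 n, ctr W i) =
      ⟪ket W 1, ((∑ i ∈ Finset.Icc 1 n, ctr W i) ^ k) (ket W 1)⟫_ℂ := by
    rw [wordState_apply, List.ofFn_const, List.prod_replicate]
  rw [cltLaw, integral_pow_law, ← Complex.re_sum,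
    ← MultilinearMap.map_sum_finset (wordState W k) (fun _ i => ctr W i), h1]
  have h2 : (s W n : GNS W →L[ℂ] GNS W) ^ k =
      ((Real.sqrt n)⁻¹) ^ k • (∑ i ∈ Finset.Icc 1 n, ctr W i) ^ k := by
    rw [← smul_pow]
    rfl
  rw [h2, smul_apply, inner_smul_right_eq_smul, Complex.real_smul, Complex.re_ofReal_mul]

/-- A pairing has `n (n-1) ⋯` words of equal expectation, asymptotically `n ^ (k/2)` of them. If `π`
is not a pairing, no `ρ` lies over it and the limit is `0`: a singleton block kills every word, and
otherwise there are fewer than `k/2` blocks. -/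
theorem tendsto_kerPartition_sum {k : ℕ} (hk : 1 ≤ k)
    (π : Finpartition (Finset.univ : Finset (Fin k))) :
    Tendsto (fun n : ℕ => ((Real.sqrt n)⁻¹) ^ k *
      ∑ j ∈ (Fintype.piFinset fun _ : Fin k => Finset.Icc 1 n) with kerPartition j = π,
        (wordState W k fun l => ctr W (j l)).re) atTop
      (𝓝 (∑ ρ : BicolouredPairPartition k with ρ.toFinpartition = π, ρ.weight W hk)) := by
  have hmem : ∀ {n : ℕ} {j : Fin k → ℕ}, j ∈ (Fintype.piFinset fun _ : Fin k =>
      Finset.Icc 1 n).filter (fun j => kerPartition j = π) →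
      (∀ l, j l ≠ 0) ∧ ∀ a b, j a = j b ↔ π.part a = π.part b := by
    intro n j hj
    simp only [Finset.mem_filter, Fintype.mem_piFinset, eq_kerPartition_iff, Finset.mem_Icc] at hj
    exact ⟨fun l => by have := hj.1 l; omega, hj.2⟩
  have hcard : ∑ V ∈ π.parts, V.card = k := by rw [π.sum_card_parts]; simp
  by_cases hπ : ∀ V ∈ π.parts, V.card = 2
  · have hk2 : k = 2 * π.parts.card := by
      rw [Finset.sum_congr rfl hπ, Finset.sum_const] at hcard
      rw [smul_eq_mul] at hcard
      omega
    have h := (tendsto_inv_sqrt_pow_mul_descFactorial hk2).mul_const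
      (∑ ρ : BicolouredPairPartition k with ρ.toFinpartition = π, ρ.weight W hk)
    rw [one_mul] at h
    refine h.congr fun n => ?_
    have e : ∀ j ∈ (Fintype.piFinset fun _ : Fin k => Finset.Icc 1 n).filter
        (fun j => kerPartition j = π), (wordState W k fun l => ctr W (j l)).re =
        ∑ ρ : BicolouredPairPartition k with ρ.toFinpartition = π, ρ.weight W hk := fun j hj => by
      rw [wordState_ctr_of_pairs hk hπ (hmem hj).1 (hmem hj).2, Complex.ofReal_re]
    rw [Finset.sum_congr rfl e, Finset.sum_const, card_filter_kerPartition, nsmul_eq_mul, mul_assoc]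
  · have h0 : ∑ ρ : BicolouredPairPartition k with ρ.toFinpartition = π, ρ.weight W hk = 0 := by
      refine Finset.sum_eq_zero fun ρ hρ => absurd ?_ hπ
      rw [← (Finset.mem_filter.1 hρ).2]
      exact ρ.card_eq_two
    rw [h0]
    by_cases h1 : ∃ V ∈ π.parts, V.card = 1
    · obtain ⟨V, hV, hV1⟩ := h1
      obtain ⟨p, rfl⟩ := Finset.card_eq_one.1 hV1
      refine tendsto_const_nhds.congr fun n => ?_
      rw [Finset.sum_eq_zero, mul_zero]
      intro j hj
      rw [wordState_ctr_eq_zero (hmem hj).1 (p := p), Complex.zero_re]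
      intro l hl
      have : l ∈ π.part p := ((hmem hj).2 l p).1 hl ▸ π.mem_part (Finset.mem_univ l)
      rw [π.part_eq_of_mem hV (Finset.mem_singleton_self p)] at this
      exact Finset.mem_singleton.1 this
    · have hlt : 2 * π.parts.card < k := by
        have h2 : ∀ V ∈ π.parts, 2 ≤ V.card := fun V hV => by
          have := (π.nonempty_of_mem_parts hV).card_pos
          have : V.card ≠ 1 := fun h => h1 ⟨V, hV, h⟩
          omega
        push Not at hπ
        obtain ⟨V, hV, hV2⟩ := hπ
        calc 2 * π.parts.card = ∑ V ∈ π.parts, 2 := by rw [Finset.sum_const, smul_eq_mul, mul_comm]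
          _ < ∑ V ∈ π.parts, V.card :=
            Finset.sum_lt_sum h2 ⟨V, hV, lt_of_le_of_ne (h2 V hV) hV2.symm⟩
          _ = k := hcard
      -- Here only the uniform bound `2 ^ k` on expectations is needed, as the number of words is of
      -- smaller order than `n ^ (k/2)`.
      have h := (tendsto_inv_sqrt_pow_mul_descFactorial_zero hlt).mul_const ((2 : ℝ) ^ k)
      rw [zero_mul] at h
      refine squeeze_zero_norm (fun n => ?_) h
      rw [norm_mul, norm_pow, norm_inv, Real.norm_of_nonneg (Real.sqrt_nonneg _), mul_assoc]
      refine mul_le_mul_of_nonneg_left ?_ (by positivity)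
      refine (norm_sum_le_of_le _ fun j _ => (Complex.abs_re_le_norm _).trans
        (norm_wordState_ctr_le j)).trans ?_
      rw [Finset.sum_const, card_filter_kerPartition, nsmul_eq_mul]

theorem tendsto_moment_cltLaw (k : ℕ) :
    Tendsto (fun n => ∫ t : ℝ, t ^ k ∂(cltLaw W n : Measure ℝ)) atTop (𝓝 (limitMoment W k)) := by
  unfold limitMoment
  split_ifs with hk
  · have h := tendsto_finsetSum Finset.univ fun (π : Finpartition (Finset.univ : Finset (Fin k)))
      _ => tendsto_kerPartition_sum W hk π
    rw [Finset.sum_fiberwise] at h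
    refine h.congr fun n => ?_
    rw [moment_cltLaw, ← Finset.mul_sum, Finset.sum_fiberwise]
  · obtain rfl : k = 0 := by omega
    simp

end StarCLT

end

theorem proposition7p6 (d : ℕ) (hd : 2 ≤ d) (W : StarCLT.Weights d) :
    ∃ μ : ProbabilityMeasure ℝ,
      Tendsto (StarCLT.cltLaw W) atTop (𝓝 μ) ∧
      ∀ (k : ℕ) (hk : 1 ≤ k),
        Integrable (fun t : ℝ => t ^ k) (μ : Measure ℝ) ∧
        ∫ t : ℝ, t ^ k ∂(μ : Measure ℝ) =
          ∑ i : Fin k → Fin d, W.w (i ⟨0, hk⟩) *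
            ∑ ρ : StarCLT.BicolouredPairPartition k with i ∘ finRotate k = i ∘ ρ.sigmaBlue,
              (∏ x ∈ ρ.bluePairs, W.w (i x.2)) *
                ∏ x ∈ ρ.redPairs, -(W.w (i x.1) * W.w (i x.2)) := by
  have hC : (0 : ℝ) < 2 * d := by
    have : (0 : ℝ) < d := by exact_mod_cast (by omega : 0 < d)
    positivity
  obtain ⟨μ, hμ, hm⟩ := MomentMethod.exists_tendsto_of_moment hC
    (fun n k => StarCLT.integrable_pow_law _ _ _ k) (StarCLT.tendsto_moment_cltLaw W)
    (StarCLT.limitMoment_le W)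
  refine ⟨μ, hμ, fun k hk => ⟨(hm k).1, ?_⟩⟩
  rw [(hm k).2, StarCLT.limitMoment, dif_pos hk]
  -- Both sides are the same double sum over compatible `i` and `ρ`, taken in opposite orders.
  simp_rw [StarCLT.BicolouredPairPartition.weight, Finset.mul_sum, Finset.sum_filter]
  exact Finset.sum_comm
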